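/- Let $N\ge 1$, let $\Omega=\mathbb T^{N-1}\times(0,1)$ with $\mathbb T=\mathbb R/\mathbb Z$ be the flat cylinder, with boundary $\partial\Omega=\mathbb T^{N-1}\times\{0,1\}$ and outer unit normal $\nu$, let $d(x)=\operatorname{dist}(x,\partial\Omega)$, fix $\varepsilon>0$, and set $a_\varepsilon=\min\{d/\varepsilon,1\}$. For $u\in L^2(\Omega)$ let $E_\varepsilon(u)=\frac12\int_\Omega a_\varepsilon|\nabla u|^2\,dx$ if $u\in H^1_{loc}(\Omega)$ and $E_\varepsilon(u)=+\infty$ otherwise. Let $\gamma:H^1(\Omega)\to L^2(\partial\Omega)$ be the trace operator and let $H^{1/2}(\partial\Omega)=\gamma(H^1(\Omega))$, with the norm $\|g\|=\inf\{\|v\|_{H^1(\Omega)}:\gamma(v)=g\}$. The normal trace $F\cdot\nu$ on $\partial\Omega$ of a vector field $F\in L^2(\Omega)^N$ with weak divergence $\operatorname{div}F\in L^2(\Omega)$ is the functional $T\in (H^{1/2}(\partial\Omega))^*$ with $$\langle T,\gamma(v)\rangle=\int_\Omega F\cdot\nabla v\,dx+\int_\Omega v\,\operatorname{div}F\,dx\qquad\text{for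 all }v\in H^1(\Omega).$$ Lemma. Suppose that $u\in L^2(\Omega)$ is such that (1) $E_\varepsilon(u)<\infty$ and (2) the weak divergence $\operatorname{div}(a_\varepsilon\nabla u)$ belongs to $L^2(\Omega)$. Then the trace of $a_\varepsilon\frac{\partial u}{\partial\nu}$ on $\partial\Omega$, that is, the normal trace of the field $a_\varepsilon\nabla u\in L^2(\Omega)^N$, exists, is unique, and is zero. Hence no explicit boundary condition is needed for $\operatorname{div}(a_\varepsilon\nabla u)=f\in L^2(\Omega)$, in the sense that integration by parts produces no boundary term: $$\int_\Omega a_\varepsilon\nabla u\cdot\nabla v\,dx=-\int_\Omega v\,\operatorname{div}(a_\varepsilon\nabla u)\,dx\qquad\text{for all }v\in H^1(\Omega).$$ -/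

import Mathlib

open MeasureTheory Set
open scoped ENNReal

noncomputable section

namespace FlatCylinder

/-! ### The flat cylinder `Ω = 𝕋ⁿ × (0, 1)`, of dimension `N = n + 1` -/

/-- The ambient space `𝕋ⁿ × ℝ`, where `𝕋 = ℝ / ℤ`; the last coordinate `x_N` is `x.2`. -/
abbrev Cyl (n : ℕ) : Type := (Fin n → UnitAddCircle) × ℝ

/-- The covering map `ℝⁿ × ℝ → 𝕋ⁿ × ℝ`. -/
def cover {n : ℕ} (x : (Fin n → ℝ) × ℝ) : Cyl n :=
  (fun i => ((x.1 i : ℝ) : UnitAddCircle), x.2)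

/-- The domain `Ω = 𝕋ⁿ × (0, 1)`. -/
def Omega (n : ℕ) : Set (Cyl n) := univ ×ˢ Ioo (0 : ℝ) 1

/-- Lebesgue measure on `Ω`. -/
def volOmega (n : ℕ) : Measure (Cyl n) := (volume : Measure (Cyl n)).restrict (Omega n)

/-- The surface measure of `∂Ω = 𝕋ⁿ × {0, 1}`. -/
def surf (n : ℕ) : Measure (Cyl n) :=
  (volume : Measure (Fin n → UnitAddCircle)).prod (Measure.dirac (0 : ℝ) + Measure.dirac (1 : ℝ))

/-- The distance `d(x)` of `x` to `∂Ω`. (The distance from a point of the cylinder to `∂Ω` is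
attained in the vertical direction, so it is the same for the maximum metric of the product as
for the Euclidean one; see `distBdry_eq`.) -/
def distBdry {n : ℕ} (x : Cyl n) : ℝ := Metric.infDist x (frontier (Omega n))

/-- The weight `a_ε = min (d / ε, 1)`. -/
def weight {n : ℕ} (ε : ℝ) (x : Cyl n) : ℝ := min (distBdry x / ε) 1

/-! ### Smooth functions, test functions, weak derivatives -/

/-- The coordinate directions `e_1, …, e_N`; the last one is the direction of `(0, 1)`. -/
def dir {n : ℕ} (i : Fin (n + 1)) : (Fin n → ℝ) × ℝ :=
  Fin.lastCases (motive := fun _ => (Fin n → ℝ) × ℝ) (0, 1) (fun j => (Pi.single j 1, 0)) i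

/-- The classical partial derivative `∂φ/∂x_i` on `𝕋ⁿ × ℝ`. -/
def pderiv {n : ℕ} (i : Fin (n + 1)) (φ : Cyl n → ℝ) (x : Cyl n) : ℝ :=
  deriv (fun s : ℝ => φ (x + cover (s • dir i))) 0

/-- `φ ∈ C^∞(𝕋ⁿ × ℝ)`. -/
def IsSmooth {n : ℕ} (φ : Cyl n → ℝ) : Prop :=
  ContDiff ℝ ((⊤ : ℕ∞) : WithTop ℕ∞) (fun x : (Fin n → ℝ) × ℝ => φ (cover x))

/-- `φ ∈ C_c^∞(Ω)`. -/
def IsTest {n : ℕ} (φ : Cyl n → ℝ) : Prop :=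
  IsSmooth φ ∧ HasCompactSupport φ ∧ tsupport φ ⊆ Omega n

/-- `g` is the weak partial derivative `∂u/∂x_i` in `Ω`. -/
def IsWeakDeriv {n : ℕ} (i : Fin (n + 1)) (u g : Cyl n → ℝ) : Prop :=
  ∀ φ : Cyl n → ℝ, IsTest φ →
    ∫ x, u x * pderiv i φ x ∂(volOmega n) = -∫ x, g x * φ x ∂(volOmega n)

/-- `f` is the weak divergence of the vector field `F` in `Ω`. -/
def HasWeakDiv {n : ℕ} (F : Fin (n + 1) → Cyl n → ℝ) (f : Cyl n → ℝ) : Prop :=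
  ∀ φ : Cyl n → ℝ, IsTest φ →
    ∫ x, ∑ i, F i x * pderiv i φ x ∂(volOmega n) = -∫ x, f x * φ x ∂(volOmega n)

/-- `g ∈ L²_loc(Ω)`. -/
def MemL2loc {n : ℕ} (g : Cyl n → ℝ) : Prop :=
  ∀ K : Set (Cyl n), IsCompact K → K ⊆ Omega n → MemLp g 2 (volume.restrict K)

/-- `G` is the weak gradient of `u` in `Ω`, with `G ∈ L²_loc(Ω)`. -/
def IsWeakGrad {n : ℕ} (u : Cyl n → ℝ) (G : Fin (n + 1) → Cyl n → ℝ) : Prop :=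
  ∀ i, MemL2loc (G i) ∧ IsWeakDeriv i u (G i)

/-- `u ∈ H¹_loc(Ω)`. -/
def MemH1loc {n : ℕ} (u : Cyl n → ℝ) : Prop :=
  MemL2loc u ∧ ∃ G : Fin (n + 1) → Cyl n → ℝ, IsWeakGrad u G

open Classical in
/-- The weak gradient `∇u` of `u ∈ H¹_loc(Ω)` (a representative: it is unique almost everywhere
in `Ω`). The value for `u ∉ H¹_loc(Ω)` is irrelevant. -/
def weakGrad {n : ℕ} (u : Cyl n → ℝ) : Fin (n + 1) → Cyl n → ℝ :=
  if h : MemH1loc u then h.2.choose else 0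

open Classical in
/-- The energy `E_ε(u) = ½ ∫_Ω a_ε |∇u|²` if `u ∈ H¹_loc(Ω)`, and `+∞` otherwise. -/
def energy {n : ℕ} (ε : ℝ) (u : Cyl n → ℝ) : ℝ≥0∞ :=
  if MemH1loc u then
    2⁻¹ * ∫⁻ x, ENNReal.ofReal (weight ε x * ∑ i, weakGrad u i x ^ 2) ∂(volOmega n)
  else ⊤

/-- The vector field `a_ε ∇u`. -/
def flux {n : ℕ} (ε : ℝ) (u : Cyl n → ℝ) : Fin (n + 1) → Cyl n → ℝ :=
  fun i x => weight ε x * weakGrad u i x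

/-! ### Facts about smooth functions that the function spaces below need -/

theorem cover_add {n : ℕ} (x y : (Fin n → ℝ) × ℝ) : cover (x + y) = cover x + cover y := by
  ext <;> simp [cover]

theorem isOpenQuotientMap_cover {n : ℕ} :
    IsOpenQuotientMap (cover : (Fin n → ℝ) × ℝ → Cyl n) := by
  have h1 : IsOpenQuotientMap (fun x : ℝ => (x : UnitAddCircle)) :=
    QuotientAddGroup.isOpenQuotientMap_mk
  have h2 := IsOpenQuotientMap.piMap (fun _ : Fin n => h1)
  exact h2.prodMap IsOpenQuotientMap.id

theorem hasDerivAt_slice {n : ℕ} {φ : Cyl n → ℝ} (h : IsSmooth φ) (i : Fin (n + 1))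
    (x : (Fin n → ℝ) × ℝ) :
    HasDerivAt (fun s : ℝ => φ (cover x + cover (s • dir i)))
      (fderiv ℝ (fun y => φ (cover y)) x (dir i)) 0 := by
  have hd : HasFDerivAt (fun y => φ (cover y)) (fderiv ℝ (fun y => φ (cover y)) x)
      (x + (0 : ℝ) • dir i) := by
    simpa using (h.differentiable (by simp) x).hasFDerivAt
  have hl : HasDerivAt (fun s : ℝ => x + s • dir i) (dir i) 0 := by
    simpa using ((hasDerivAt_id (0 : ℝ)).smul_const (dir i)).const_add x
  have := hd.comp_hasDerivAt (0 : ℝ) hl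
  simpa only [Function.comp_def, cover_add] using this

theorem pderiv_cover {n : ℕ} {φ : Cyl n → ℝ} (h : IsSmooth φ) (i : Fin (n + 1))
    (x : (Fin n → ℝ) × ℝ) :
    pderiv i φ (cover x) = fderiv ℝ (fun y => φ (cover y)) x (dir i) :=
  (hasDerivAt_slice h i x).deriv

theorem IsSmooth.continuous {n : ℕ} {φ : Cyl n → ℝ} (h : IsSmooth φ) : Continuous φ :=
  isOpenQuotientMap_cover.isQuotientMap.continuous_iff.2 (ContDiff.continuous h)

theorem IsSmooth.continuous_pderiv {n : ℕ} {φ : Cyl n → ℝ} (h : IsSmooth φ) (i : Fin (n + 1)) :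
    Continuous (pderiv i φ) := by
  refine isOpenQuotientMap_cover.isQuotientMap.continuous_iff.2 ?_
  have : pderiv i φ ∘ cover = fun x => fderiv ℝ (fun y => φ (cover y)) x (dir i) :=
    funext fun x => pderiv_cover h i x
  rw [this]
  exact (h.continuous_fderiv (by simp)).clm_apply continuous_const

theorem IsSmooth.pderiv_add {n : ℕ} {φ ψ : Cyl n → ℝ} (h : IsSmooth φ) (h' : IsSmooth ψ)
    (i : Fin (n + 1)) : pderiv i (φ + ψ) = pderiv i φ + pderiv i ψ := by
  funext x
  obtain ⟨y, rfl⟩ := isOpenQuotientMap_cover.surjective x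
  rw [Pi.add_apply, pderiv_cover h, pderiv_cover h']
  exact ((hasDerivAt_slice h i y).add (hasDerivAt_slice h' i y)).deriv

theorem pderiv_smul {n : ℕ} (c : ℝ) (φ : Cyl n → ℝ) (i : Fin (n + 1)) :
    pderiv i (c • φ) = c • pderiv i φ := by
  funext x
  simp [pderiv]

theorem pderiv_eq_zero {n : ℕ} {φ : Cyl n → ℝ} (i : Fin (n + 1)) {x : Cyl n}
    (hx : x ∉ tsupport φ) : pderiv i φ x = 0 := by
  have h0 : φ =ᶠ[nhds x] 0 := notMem_tsupport_iff_eventuallyEq.1 hx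
  have hc : Continuous (fun s : ℝ => x + cover (s • dir i)) := by
    have := isOpenQuotientMap_cover (n := n) |>.continuous
    fun_prop
  have ht : Filter.Tendsto (fun s : ℝ => x + cover (s • dir i)) (nhds 0) (nhds x) := by
    have h2 : x + cover ((0 : ℝ) • dir i) = x := by ext <;> simp [cover]
    have h3 := hc.tendsto 0
    rwa [h2] at h3
  have : (fun s : ℝ => φ (x + cover (s • dir i))) =ᶠ[nhds 0] fun _ => (0 : ℝ) :=
    ht.eventually h0
  rw [pderiv, this.deriv_eq, deriv_const]

theorem IsTest.memLp {n : ℕ} {φ : Cyl n → ℝ} (h : IsTest φ) : MemLp φ 2 (volOmega n) :=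
  (h.1.continuous.memLp_of_hasCompactSupport h.2.1).restrict _

theorem IsTest.memLp_pderiv {n : ℕ} {φ : Cyl n → ℝ} (h : IsTest φ) (i : Fin (n + 1)) :
    MemLp (pderiv i φ) 2 (volOmega n) := by
  refine ((h.1.continuous_pderiv i).memLp_of_hasCompactSupport ?_).restrict _
  exact HasCompactSupport.intro h.2.1 fun x hx => pderiv_eq_zero i hx

/-- In `Ω` the distance to the boundary is `min (x_N, 1 - x_N)`. -/
theorem distBdry_eq {n : ℕ} {x : Cyl n} (hx : x ∈ Omega n) :
    distBdry x = min x.2 (1 - x.2) := by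
  have hx2 : 0 < x.2 ∧ x.2 < 1 := by simpa [Omega] using hx
  have hfr : frontier (Omega n) = univ ×ˢ ({0, 1} : Set ℝ) := by
    rw [Omega, frontier_univ_prod_eq, frontier_Ioo zero_lt_one]
  have hm : ∀ t ∈ ({0, 1} : Set ℝ), Metric.infDist x (frontier (Omega n)) ≤ |x.2 - t| := by
    intro t ht
    have hmem : ((x.1, t) : Cyl n) ∈ frontier (Omega n) := by rw [hfr]; exact ⟨mem_univ _, ht⟩
    refine (Metric.infDist_le_dist_of_mem hmem).trans_eq ?_
    simp [Prod.dist_eq, Real.dist_eq]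
  refine le_antisymm (le_min ?_ ?_) ?_
  · have := hm 0 (by simp)
    rwa [sub_zero, abs_of_pos hx2.1] at this
  · have := hm 1 (by simp)
    rwa [abs_of_neg (by linarith), neg_sub] at this
  · refine (Metric.le_infDist ⟨((x.1, 0) : Cyl n), by rw [hfr]; simp⟩).2 ?_
    intro y hy
    rw [hfr] at hy
    have h1 : |x.2 - y.2| ≤ dist x y := by
      rw [Prod.dist_eq, ← Real.dist_eq]; exact le_max_right _ _
    refine le_trans ?_ h1
    rcases hy.2 with h | h
    · rw [h, sub_zero, abs_of_pos hx2.1]; exact min_le_left _ _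
    · rw [mem_singleton_iff.1 h, abs_of_neg (by linarith), neg_sub]; exact min_le_right _ _

/-! ### `H¹(Ω)`, the trace, `H^{1/2}(∂Ω)` and its dual -/

/-- `L²(Ω)`. -/
abbrev L2 (n : ℕ) : Type := Lp ℝ 2 (volOmega n)

/-- `L²(∂Ω)`. -/
abbrev L2Bdry (n : ℕ) : Type := Lp ℝ 2 (surf n)

/-- The Hilbert space `L²(Ω)^{1+N}`: the entry `none` stands for a function and the entries
`some i` for its derivatives. -/
abbrev Jet (n : ℕ) : Type := PiLp 2 (fun _ : Option (Fin (n + 1)) => L2 n)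

/-- The Sobolev space `H¹(Ω)`, as the space of pairs `(v, ∇v)` in `L²(Ω)^{1+N}`, with the norm
`(‖v‖² + ∑ ‖∂v/∂x_i‖²)^{1/2}`. -/
def H1 (n : ℕ) : Submodule ℝ (Jet n) where
  carrier := {v | ∀ i : Fin (n + 1), IsWeakDeriv i (v none) (v (some i))}
  add_mem' := by
    intro v w hv hw i φ hφ
    have e1 := Lp.coeFn_add (v none) (w none)
    have e2 := Lp.coeFn_add (v (some i)) (w (some i))
    have i1 : ∀ z : L2 n, Integrable (fun x => z x * pderiv i φ x) (volOmega n) :=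
      fun z => (Lp.memLp z).integrable_mul (hφ.memLp_pderiv i)
    have i2 : ∀ z : L2 n, Integrable (fun x => z x * φ x) (volOmega n) :=
      fun z => (Lp.memLp z).integrable_mul hφ.memLp
    have l : ∫ x, (v + w) none x * pderiv i φ x ∂(volOmega n) =
        ∫ x, v none x * pderiv i φ x + w none x * pderiv i φ x ∂(volOmega n) := by
      refine integral_congr_ae ?_
      filter_upwards [e1] with x hx
      have : (v + w) none x = v none x + w none x := hx
      rw [this, add_mul]
    have r : ∫ x, (v + w) (some i) x * φ x ∂(volOmega n) =
        ∫ x, v (some i) x * φ x + w (some i) x * φ x ∂(volOmega n) := by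
      refine integral_congr_ae ?_
      filter_upwards [e2] with x hx
      have : (v + w) (some i) x = v (some i) x + w (some i) x := hx
      rw [this, add_mul]
    rw [l, r, integral_add (i1 _) (i1 _), integral_add (i2 _) (i2 _), hv i φ hφ, hw i φ hφ]
    ring
  zero_mem' := by
    intro i φ _
    have e := Lp.coeFn_zero ℝ 2 (volOmega n)
    have h : ∀ ψ : Cyl n → ℝ, ∫ x, (0 : L2 n) x * ψ x ∂(volOmega n) = 0 := by
      intro ψ
      refine integral_eq_zero_of_ae ?_
      filter_upwards [e] with x hx
      rw [hx, Pi.zero_apply]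
      exact zero_mul _
    exact (h _).trans (by rw [← neg_zero, ← h φ]; rfl)
  smul_mem' := by
    intro c v hv i φ hφ
    have h : ∀ (z : L2 n) (ψ : Cyl n → ℝ),
        ∫ x, (c • z : L2 n) x * ψ x ∂(volOmega n) = c * ∫ x, z x * ψ x ∂(volOmega n) := by
      intro z ψ
      rw [← integral_const_mul]
      refine integral_congr_ae ?_
      filter_upwards [Lp.coeFn_smul c z] with x hx
      rw [hx, Pi.smul_apply, smul_eq_mul, mul_assoc]
    have l := h (v none) (pderiv i φ)
    have r := h (v (some i)) φ
    have hv' := hv i φ hφ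
    refine l.trans ?_
    rw [hv', mul_neg, ← r]
    rfl

/-- The graph of `ψ ↦ ψ|_{∂Ω}` for `ψ ∈ C^∞(closure of Ω)`, inside `H¹(Ω) × L²(∂Ω)`. -/
def smoothTraceGraph (n : ℕ) : Submodule ℝ (H1 n × L2Bdry n) where
  carrier := {p | ∃ ψ : Cyl n → ℝ, IsSmooth ψ ∧
    p.1.1 none =ᵐ[volOmega n] ψ ∧
    (∀ i : Fin (n + 1), p.1.1 (some i) =ᵐ[volOmega n] pderiv i ψ) ∧
    p.2 =ᵐ[surf n] ψ}
  add_mem' := by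
    rintro p q ⟨ψ, s, h0, h1, h2⟩ ⟨χ, s', h0', h1', h2'⟩
    refine ⟨ψ + χ, ContDiff.add s s', ?_, fun i => ?_, ?_⟩
    · exact (Lp.coeFn_add _ _).trans (h0.add h0')
    · rw [s.pderiv_add s']
      exact (Lp.coeFn_add _ _).trans ((h1 i).add (h1' i))
    · exact (Lp.coeFn_add _ _).trans (h2.add h2')
  zero_mem' := by
    refine ⟨0, contDiff_const, Lp.coeFn_zero _ _ _, fun i => ?_, Lp.coeFn_zero _ _ _⟩
    have : pderiv i (0 : Cyl n → ℝ) = 0 := by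
      funext x
      simp [pderiv]
    rw [this]
    exact Lp.coeFn_zero _ _ _
  smul_mem' := by
    rintro c p ⟨ψ, s, h0, h1, h2⟩
    refine ⟨c • ψ, ContDiff.const_smul c s, ?_, fun i => ?_, ?_⟩
    · exact (Lp.coeFn_smul _ _).trans (h0.const_smul c)
    · rw [pderiv_smul]
      exact (Lp.coeFn_smul _ _).trans ((h1 i).const_smul c)
    · exact (Lp.coeFn_smul _ _).trans (h2.const_smul c)

/-- The graph of the trace operator `γ : H¹(Ω) → L²(∂Ω)`, the closure of the restriction
operator on smooth functions. -/
def traceGraph (n : ℕ) : Submodule ℝ (H1 n × L2Bdry n) :=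
  (smoothTraceGraph n).topologicalClosure

/-- `γ(v) = g`. -/
def IsTrace {n : ℕ} (v : H1 n) (g : L2Bdry n) : Prop := (v, g) ∈ traceGraph n

/-- `H^{1/2}(∂Ω) = γ(H¹(Ω))`. -/
def HHalf (n : ℕ) : Submodule ℝ (L2Bdry n) :=
  (traceGraph n).map (LinearMap.snd ℝ (H1 n) (L2Bdry n))

/-- The norm `‖g‖ = inf {‖v‖_{H¹(Ω)} : γ(v) = g}` of `H^{1/2}(∂Ω)`. -/
def hHalfNorm {n : ℕ} (g : HHalf n) : ℝ := ⨅ v : {v : H1 n // IsTrace v g.1}, ‖v.1‖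

/-- The dual space `(H^{1/2}(∂Ω))*` of bounded linear functionals. -/
def HHalfDual (n : ℕ) : Submodule ℝ (HHalf n →ₗ[ℝ] ℝ) where
  carrier := {T | ∃ C : ℝ, ∀ g : HHalf n, |T g| ≤ C * hHalfNorm g}
  add_mem' := by
    rintro S T ⟨C, hC⟩ ⟨D, hD⟩
    refine ⟨C + D, fun g => ?_⟩
    rw [LinearMap.add_apply, add_mul]
    exact (abs_add_le _ _).trans (add_le_add (hC g) (hD g))
  zero_mem' := ⟨0, fun g => by simp⟩
  smul_mem' := by
    rintro c T ⟨C, hC⟩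
    refine ⟨|c| * C, fun g => ?_⟩
    rw [LinearMap.smul_apply, smul_eq_mul, abs_mul, mul_assoc]
    exact mul_le_mul_of_nonneg_left (hC g) (abs_nonneg c)

/-- `T ∈ (H^{1/2}(∂Ω))*` is the normal trace `F · ν` on `∂Ω` of a field `F ∈ L²(Ω)^N` with
`div F = f ∈ L²(Ω)`:  `⟨T, γ(v)⟩ = ∫_Ω F · ∇v + ∫_Ω f v` for all `v ∈ H¹(Ω)`. -/
def IsNormalTrace {n : ℕ} (F : Fin (n + 1) → Cyl n → ℝ) (f : L2 n) (T : HHalfDual n) : Prop :=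
  (∀ i, MemLp (F i) 2 (volOmega n)) ∧ HasWeakDiv F f ∧
    ∀ (v : H1 n) (g : HHalf n), IsTrace v g.1 →
      T.1 g = ∫ x, ∑ i, F i x * v.1 (some i) x ∂(volOmega n) +
        ∫ x, f x * v.1 none x ∂(volOmega n)

end FlatCylinder

end

open MeasureTheory Set
open scoped ENNReal

noncomputable section

namespace FlatCylinder

open Filter Topology UnitAddTorus

/-! ### Products of a trigonometric monomial on the torus and a function of the last variable -/

/-! Write `a ∇u = √a · (√a ∇u)`. Finite energy says exactly that `√a ∇u` is in `L²`, and the spare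
factor `√a` kills the boundary term. Test the weak divergence with `η_j ψ`, where `ψ` is smooth up
to the boundary and `η_j` is a cutoff of the last variable. The only unwanted term is `∫ a ∂_N u
η_j' ψ`. On the layer of width about `1/j` where `η_j'` lives, `η_j'` is of order `j` and `a` is at
most of order `1/j`, so `√a η_j' ψ` is bounded in `L²`. It also vanishes eventually at each point of
`Ω`, hence tends weakly to `0` (`tendsto_integral_flux_deriv_cutoff`). This gives `∫ a ∇u · ∇ψ = -∫
f ψ`.

To pass to all `v` in `H¹`, only `ψ = Re (c e^{2πi k·x}) cos (mπt)`, the Neumann eigenfunctions, are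
needed. They are total in `H¹`: if `v` is `H¹`-orthogonal to such a `ψ`, Green's formula turns the
inner product into `(1 + λ) ∫ v ψ` with `λ ≥ 0`, so `∫ v ψ = 0`; Stone–Weierstrass then forces `v =
0` (`eq_zero_of_inner_neumannFun`). The identity is the orthogonality of the jet `(f, a ∇u)` to
`H¹`, so it extends by closure (`inner_eq_zero_of_neumannFun`). The zero functional is therefore a
normal trace, and the only one because every element of `H^{1/2}` is a trace. -/

/-- The function `(x, t) ↦ Re (c e^{2πi k·x}) h(t)` on `𝕋ⁿ × ℝ`. -/
def trigTensor {n : ℕ} (c : ℂ) (k : Fin n → ℤ) (h : ℝ → ℝ) (x : Cyl n) : ℝ :=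
  (c * mFourier k x.1).re * h x.2

theorem mFourier_add_apply {n : ℕ} (k : Fin n → ℤ) (x y : Fin n → UnitAddCircle) :
    mFourier k (x + y) = mFourier k x * mFourier k y := by
  simp [mFourier, fourier_apply, Finset.prod_mul_distrib, AddCircle.toCircle_add]

theorem mFourier_coe {n : ℕ} (k : Fin n → ℤ) (y : Fin n → ℝ) :
    mFourier k (fun i => (y i : UnitAddCircle)) =
      Complex.exp (2 * Real.pi * Complex.I * ∑ i, (k i : ℂ) * (y i : ℂ)) := by
  rw [Finset.mul_sum, Complex.exp_sum]
  change ∏ i, fourier (k i) (y i : UnitAddCircle) = _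
  refine Finset.prod_congr rfl fun i _ => ?_
  rw [fourier_coe_apply]
  congr 1
  push_cast
  ring

theorem isSmooth_trigTensor {n : ℕ} (c : ℂ) (k : Fin n → ℤ) {h : ℝ → ℝ}
    (hh : ContDiff ℝ ((⊤ : ℕ∞) : WithTop ℕ∞) h) : IsSmooth (trigTensor c k h) := by
  have e : (fun x : (Fin n → ℝ) × ℝ => trigTensor c k h (cover x)) = fun x =>
      Complex.reCLM (c * Complex.exp (2 * Real.pi * Complex.I *
        ∑ i, (k i : ℂ) * Complex.ofRealCLM (x.1 i))) * h x.2 := by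
    funext x
    simp only [trigTensor, cover, mFourier_coe, Complex.reCLM_apply, Complex.ofRealCLM_apply]
  rw [IsSmooth, e]
  have h1 : ContDiff ℝ ((⊤ : ℕ∞) : WithTop ℕ∞) (fun x : (Fin n → ℝ) × ℝ =>
      Complex.exp (2 * Real.pi * Complex.I *
        ∑ i, (k i : ℂ) * Complex.ofRealCLM (x.1 i))) := by
    refine Complex.contDiff_exp.comp (contDiff_const.mul (ContDiff.sum fun i _ => ?_))
    refine contDiff_const.mul (Complex.ofRealCLM.contDiff.comp ?_)
    fun_prop
  refine ContDiff.mul (Complex.reCLM.contDiff.comp (contDiff_const.mul h1)) ?_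
  exact hh.comp contDiff_snd

theorem pderiv_trigTensor_last {n : ℕ} (c : ℂ) (k : Fin n → ℤ) {h : ℝ → ℝ}
    (hh : Differentiable ℝ h) :
    pderiv (Fin.last n) (trigTensor c k h) = trigTensor c k (deriv h) := by
  funext x
  have e : (fun s : ℝ => trigTensor c k h (x + cover (s • dir (Fin.last n)))) =
      fun s => (c * mFourier k x.1).re * h (x.2 + s) := by
    funext s
    have : x.1 + (cover (s • dir (Fin.last n)) : Cyl n).1 = x.1 := by
      ext i; simp [cover, dir]
    have h2 : (cover (s • dir (Fin.last n)) : Cyl n).2 = s := by simp [cover, dir]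
    simp only [trigTensor, Prod.fst_add, Prod.snd_add, this, h2]
  rw [pderiv, e]
  have := ((hh (x.2 + 0)).hasDerivAt.comp_const_add x.2 0).const_mul (c * mFourier k x.1).re
  rw [this.deriv, add_zero]
  rfl

/-- The complex coefficient `c` keeps the class closed under tangential derivatives, which would
otherwise exchange sines and cosines. -/
theorem pderiv_trigTensor_castSucc {n : ℕ} (c : ℂ) (k : Fin n → ℤ) (h : ℝ → ℝ) (j : Fin n) :
    pderiv j.castSucc (trigTensor c k h) =
      trigTensor (2 * Real.pi * Complex.I * k j * c) k h := by
  funext x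
  have e : (fun s : ℝ => trigTensor c k h (x + cover (s • dir j.castSucc))) =
      fun s : ℝ =>
        (c * mFourier k x.1 * Complex.exp (2 * Real.pi * Complex.I * k j * s)).re * h x.2 := by
    funext s
    have h1 : (cover (s • dir j.castSucc) : Cyl n).1 =
        fun i => (((Pi.single j s : Fin n → ℝ) i : ℝ) : UnitAddCircle) := by
      ext i
      by_cases hi : i = j
      · subst hi; simp [cover, dir]
      · simp [cover, dir, hi]
    have h2 : (cover (s • dir j.castSucc) : Cyl n).2 = 0 := by simp [cover, dir]
    have h3 : ∑ i, (k i : ℂ) * ((Pi.single j s : Fin n → ℝ) i : ℂ) = k j * s := by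
      rw [Finset.sum_eq_single j]
      · simp
      · intro i _ hi; simp [hi]
      · simp
    simp only [trigTensor, Prod.fst_add, Prod.snd_add, h1, h2, mFourier_add_apply, mFourier_coe,
      h3, add_zero]
    simp only [mul_assoc]
  rw [pderiv, e]
  have d1 : HasDerivAt (fun s : ℝ => Complex.exp (2 * Real.pi * Complex.I * k j * s))
      (2 * Real.pi * Complex.I * k j) 0 := by
    have := ((hasDerivAt_id (0 : ℝ)).ofReal_comp.const_mul (2 * Real.pi * Complex.I * k j)).cexp
    simpa using this
  have d2 := (Complex.reCLM.hasFDerivAt.comp_hasDerivAt (0 : ℝ)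
    (d1.const_mul (c * mFourier k x.1))).mul_const (h x.2)
  refine d2.deriv.trans ?_
  simp only [trigTensor, Complex.reCLM_apply]
  ring_nf

theorem trigTensor_mul {n : ℕ} (c : ℂ) (k : Fin n → ℤ) (h g : ℝ → ℝ) (x : Cyl n) :
    trigTensor c k (fun t => g t * h t) x = g x.2 * trigTensor c k h x := by
  simp only [trigTensor]; ring

theorem abs_re_mul_mFourier_le {n : ℕ} (c : ℂ) (k : Fin n → ℤ) (x : Fin n → UnitAddCircle) :
    |(c * mFourier k x).re| ≤ ‖c‖ := by
  refine (Complex.abs_re_le_norm _).trans ?_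
  rw [norm_mul]
  have := ((mFourier k).norm_coe_le_norm x).trans_eq mFourier_norm
  exact mul_le_of_le_one_right (norm_nonneg _) this

/-! ### Measure theory on `Ω` -/

theorem volOmega_eq (n : ℕ) : volOmega n =
    (volume : Measure (Fin n → UnitAddCircle)).prod (volume.restrict (Ioo (0 : ℝ) 1)) := by
  rw [volOmega, Omega, Measure.volume_eq_prod, ← Measure.prod_restrict, Measure.restrict_univ]

instance (n : ℕ) : IsProbabilityMeasure (volume : Measure (Fin n → UnitAddCircle)) :=
  ⟨by rw [volume_pi, Measure.pi_univ]; simp⟩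

instance (n : ℕ) : IsFiniteMeasure (volOmega n) := by
  rw [volOmega_eq]
  infer_instance

theorem measurableSet_Omega (n : ℕ) : MeasurableSet (Omega n) :=
  MeasurableSet.univ.prod measurableSet_Ioo

theorem ae_mem_Omega (n : ℕ) : ∀ᵐ x ∂(volOmega n), x.2 ∈ Ioo (0 : ℝ) 1 :=
  (ae_restrict_mem (measurableSet_Omega n)).mono fun _ hx => hx.2

theorem isCompact_slab (n : ℕ) (a b : ℝ) :
    IsCompact ((univ : Set (Fin n → UnitAddCircle)) ×ˢ Icc a b) :=
  isCompact_univ.prod isCompact_Icc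

theorem exists_bound_of_continuous {n : ℕ} {φ : Cyl n → ℝ} (hφ : Continuous φ) :
    ∃ C, 0 ≤ C ∧ ∀ x : Cyl n, x.2 ∈ Icc (0 : ℝ) 1 → |φ x| ≤ C := by
  obtain ⟨C, hC⟩ := (isCompact_slab n 0 1).exists_bound_of_continuousOn hφ.continuousOn
  refine ⟨max C 0, le_max_right _ _, fun x hx => ?_⟩
  exact (hC x ⟨mem_univ _, hx⟩).trans (le_max_left _ _)

theorem _root_.Continuous.memLp_volOmega {n : ℕ} {φ : Cyl n → ℝ} (hφ : Continuous φ) :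
    MemLp φ 2 (volOmega n) := by
  obtain ⟨C, -, hC⟩ := exists_bound_of_continuous hφ
  refine MemLp.of_bound hφ.aestronglyMeasurable C ?_
  filter_upwards [ae_mem_Omega n] with x hx
  exact hC x (Ioo_subset_Icc_self hx)

theorem isTest_trigTensor {n : ℕ} (c : ℂ) (k : Fin n → ℤ) {h : ℝ → ℝ} {a b : ℝ}
    (hh : ContDiff ℝ ((⊤ : ℕ∞) : WithTop ℕ∞) h) (ha : 0 < a) (hb : b < 1)
    (h0 : ∀ t, t ∉ Icc a b → h t = 0) : IsTest (trigTensor c k h) := by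
  have hK := isCompact_slab n a b
  have hs : tsupport (trigTensor c k h) ⊆ univ ×ˢ Icc a b := by
    refine closure_minimal (fun x hx => ⟨mem_univ _, ?_⟩) hK.isClosed
    by_contra hx2
    exact hx (by simp [trigTensor, h0 _ hx2])
  refine ⟨isSmooth_trigTensor c k hh, hK.of_isClosed_subset (isClosed_tsupport _) hs, hs.trans ?_⟩
  exact prod_mono le_rfl fun t ht => ⟨ha.trans_le ht.1, ht.2.trans_lt hb⟩

theorem integral_mul_eq_inner {n : ℕ} (z : L2 n) {φ : Cyl n → ℝ} (hφ : MemLp φ 2 (volOmega n)) :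
    ∫ x, z x * φ x ∂(volOmega n) = inner ℝ z (hφ.toLp φ) := by
  rw [L2.inner_def]
  refine integral_congr_ae ?_
  filter_upwards [hφ.coeFn_toLp] with x hx
  rw [hx]
  simp [mul_comm]

/-! ### Completeness of the Neumann eigenfunctions -/

/-- The function `Re (c e^{2πi k·x}) cos (mπt)`, an eigenfunction of the Neumann Laplacian. -/
def neumannFun {n : ℕ} (c : ℂ) (k : Fin n → ℤ) (m : ℤ) : Cyl n → ℝ :=
  trigTensor c k fun t => Real.cos (m * Real.pi * t)

theorem contDiff_cos_mul (m : ℤ) :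
    ContDiff ℝ ((⊤ : ℕ∞) : WithTop ℕ∞) fun t : ℝ => Real.cos (m * Real.pi * t) :=
  Real.contDiff_cos.comp (contDiff_const.mul contDiff_id)

theorem isSmooth_neumannFun {n : ℕ} (c : ℂ) (k : Fin n → ℤ) (m : ℤ) :
    IsSmooth (neumannFun c k m) :=
  isSmooth_trigTensor c k (contDiff_cos_mul m)

/-- `Re z Re w = (Re (zw) + Re (z w̄)) / 2` combined with the product formula for cosines; the two
halves give the `/ 4`. This closure under products is what Stone–Weierstrass requires. -/
theorem neumannFun_mul {n : ℕ} (c d : ℂ) (k l : Fin n → ℤ) (m p : ℤ) :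
    neumannFun c k m * neumannFun d l p =
      neumannFun (c * d / 4) (k + l) (m + p) + neumannFun (c * d / 4) (k + l) (m - p) +
      (neumannFun (c * star d / 4) (k + -l) (m + p) +
        neumannFun (c * star d / 4) (k + -l) (m - p)) := by
  funext x
  have h1 : ((m + p : ℤ) : ℝ) * Real.pi * x.2 = m * Real.pi * x.2 + p * Real.pi * x.2 := by
    push_cast; ring
  have h2 : ((m - p : ℤ) : ℝ) * Real.pi * x.2 = m * Real.pi * x.2 - p * Real.pi * x.2 := by
    push_cast; ring
  have h3 : ∀ z w : ℂ, z / 4 * w = ((1 / 4 : ℝ) : ℂ) * (z * w) := by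
    intro z w; push_cast; ring
  simp only [Pi.mul_apply, Pi.add_apply, neumannFun, trigTensor, h1, h2, Real.cos_add,
    Real.cos_sub, mFourier_add, mFourier_neg, h3, Complex.re_ofReal_mul]
  generalize mFourier k x.1 = z
  generalize mFourier l x.1 = w
  simp only [Complex.mul_re, Complex.mul_im, Complex.star_def, Complex.conj_re, Complex.conj_im]
  ring

theorem neumannFun_zero_zero {n : ℕ} : neumannFun (1 : ℂ) (0 : Fin n → ℤ) 0 = 1 := by
  funext x
  simp [neumannFun, trigTensor, mFourier_zero]

/-- The linear span of the Neumann eigenfunctions is an algebra. -/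
def neumannAlg (n : ℕ) : Subalgebra ℝ (Cyl n → ℝ) :=
  (Submodule.span ℝ {φ | ∃ c k m, φ = neumannFun (n := n) c k m}).toSubalgebra
    (Submodule.subset_span ⟨1, 0, 0, neumannFun_zero_zero.symm⟩) (by
      intro x y hx hy
      refine (Submodule.mul_le.2 ?_ : _ * _ ≤ _) (Submodule.mul_mem_mul hx hy)
      intro a ha b hb
      have := Submodule.mul_mem_mul ha hb
      rw [Submodule.span_mul_span] at this
      refine Submodule.span_le.2 ?_ this
      rintro _ ⟨_, ⟨c, k, m, rfl⟩, _, ⟨d, l, p, rfl⟩, rfl⟩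
      have hS : ∀ c k m, neumannFun c k m ∈
          Submodule.span ℝ {φ | ∃ c k m, φ = neumannFun (n := n) c k m} :=
        fun c k m => Submodule.subset_span ⟨c, k, m, rfl⟩
      simp only [neumannFun_mul]
      exact add_mem (add_mem (hS _ _ _) (hS _ _ _)) (add_mem (hS _ _ _) (hS _ _ _)))

theorem neumannFun_mem {n : ℕ} (c : ℂ) (k : Fin n → ℤ) (m : ℤ) :
    neumannFun c k m ∈ neumannAlg n :=
  Submodule.subset_span ⟨c, k, m, rfl⟩

theorem continuous_of_mem_neumannAlg {n : ℕ} {φ : Cyl n → ℝ} (h : φ ∈ neumannAlg n) :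
    Continuous φ := by
  refine Submodule.span_induction (p := fun φ _ => Continuous φ) ?_ continuous_const ?_ ?_ h
  · rintro _ ⟨c, k, m, rfl⟩
    exact (isSmooth_neumannFun c k m).continuous
  · exact fun _ _ _ _ h1 h2 => h1.add h2
  · exact fun a _ _ h1 => h1.const_smul a

theorem neumannAlg_separates {n : ℕ} {x y : Cyl n} (hx : x.2 ∈ Icc (0 : ℝ) 1)
    (hy : y.2 ∈ Icc (0 : ℝ) 1) (hxy : x ≠ y) : ∃ φ ∈ neumannAlg n, φ x ≠ φ y := by
  classical
  by_contra! H
  refine hxy (Prod.ext (funext fun i => ?_) ?_)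
  · have h1 := H _ (neumannFun_mem 1 (Pi.single i 1) 0)
    have h2 := H _ (neumannFun_mem (-Complex.I) (Pi.single i 1) 0)
    simp only [neumannFun, trigTensor, mFourier_single, fourier_one] at h1 h2
    refine AddCircle.injective_toCircle one_ne_zero (Subtype.ext (Complex.ext ?_ ?_))
    · simpa using h1
    · simpa using h2
  · have h1 := H _ (neumannFun_mem 1 0 1)
    simp only [neumannFun, trigTensor, mFourier_zero] at h1
    have h2 : Real.cos (Real.pi * x.2) = Real.cos (Real.pi * y.2) := by simpa using h1
    have h3 := Real.injOn_cos ⟨by have := hx.1; positivity,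
      mul_le_of_le_one_right Real.pi_pos.le hx.2⟩ ⟨by have := hy.1; positivity,
      mul_le_of_le_one_right Real.pi_pos.le hy.2⟩ h2
    exact mul_left_cancel₀ Real.pi_ne_zero h3

/-- Stone–Weierstrass: the Neumann eigenfunctions span a uniformly dense subspace. -/
theorem exists_mem_neumannAlg_near {n : ℕ} {φ : Cyl n → ℝ} (hφ : Continuous φ) {δ : ℝ}
    (hδ : 0 < δ) :
    ∃ p ∈ neumannAlg n, ∀ x : Cyl n, x.2 ∈ Icc (0 : ℝ) 1 → |p x - φ x| < δ := by
  set K : Set (Cyl n) := univ ×ˢ Icc (0 : ℝ) 1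
  have : CompactSpace K := isCompact_iff_compactSpace.1 (isCompact_slab n 0 1)
  let A : Subalgebra ℝ C(K, ℝ) :=
    { carrier := {f | ∃ p ∈ neumannAlg n, ∀ x : K, f x = p x}
      mul_mem' := by
        rintro f g ⟨p, hp, hf⟩ ⟨q, hq, hg⟩
        exact ⟨p * q, mul_mem hp hq, fun x => by simp [hf, hg]⟩
      add_mem' := by
        rintro f g ⟨p, hp, hf⟩ ⟨q, hq, hg⟩
        exact ⟨p + q, add_mem hp hq, fun x => by simp [hf, hg]⟩
      algebraMap_mem' := fun r => ⟨algebraMap ℝ _ r, algebraMap_mem _ r, fun x => rfl⟩ }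
  have hA : A.SeparatesPoints := by
    intro x y hxy
    obtain ⟨p, hp, hne⟩ := neumannAlg_separates x.2.2 y.2.2 (Subtype.coe_injective.ne hxy)
    exact ⟨_, ⟨⟨fun z : K => p z, (continuous_of_mem_neumannAlg hp).comp continuous_subtype_val⟩,
      ⟨p, hp, fun _ => rfl⟩, rfl⟩, hne⟩
  obtain ⟨⟨g, p, hp, hg⟩, hgφ⟩ :=
    ContinuousMap.exists_mem_subalgebra_near_continuous_of_separatesPoints A hA
      (fun x : K => φ x) (hφ.comp continuous_subtype_val) δ hδ
  refine ⟨p, hp, fun x hx => ?_⟩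
  have h1 := hgφ ⟨x, mem_univ _, hx⟩
  rw [hg ⟨x, mem_univ _, hx⟩] at h1
  exact h1

/-- For `p` in the algebra and uniformly `δ`-close to `φ`, the integral equals `∫ g (φ - p)`, which
is at most `δ ∫ |g|`. -/
theorem integral_mul_eq_zero_of_neumannFun {n : ℕ} {g : Cyl n → ℝ} (hg : MemLp g 2 (volOmega n))
    (h : ∀ c k m, ∫ x, g x * neumannFun c k m x ∂(volOmega n) = 0) {φ : Cyl n → ℝ}
    (hφ : Continuous φ) : ∫ x, g x * φ x ∂(volOmega n) = 0 := by
  have hi : ∀ {φ : Cyl n → ℝ}, Continuous φ → Integrable (fun x => g x * φ x) (volOmega n) :=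
    fun h => hg.integrable_mul h.memLp_volOmega
  have h0 : ∀ p ∈ neumannAlg n, ∫ x, g x * p x ∂(volOmega n) = 0 := by
    intro p hp
    have : Continuous p ∧ ∫ x, g x * p x ∂(volOmega n) = 0 := by
      refine Submodule.span_induction
        (p := fun φ _ => Continuous φ ∧ ∫ x, g x * φ x ∂(volOmega n) = 0) ?_ ?_ ?_ ?_ hp
      · rintro _ ⟨c, k, m, rfl⟩
        exact ⟨(isSmooth_neumannFun c k m).continuous, h c k m⟩
      · exact ⟨continuous_const, by simp⟩
      · rintro p q _ _ ⟨hp, hp0⟩ ⟨hq, hq0⟩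
        refine ⟨hp.add hq, ?_⟩
        simp only [Pi.add_apply, mul_add]
        rw [integral_add (hi hp) (hi hq), hp0, hq0, add_zero]
      · rintro a p _ ⟨hp, hp0⟩
        refine ⟨hp.const_smul a, ?_⟩
        simp only [Pi.smul_apply, smul_eq_mul, mul_left_comm _ a]
        rw [integral_const_mul, hp0, mul_zero]
    exact this.2
  have hg1 : Integrable (fun x => |g x|) (volOmega n) := (hg.integrable (by norm_num)).abs
  have hle : ∀ δ > 0, |∫ x, g x * φ x ∂(volOmega n)| ≤ δ * ∫ x, |g x| ∂(volOmega n) := by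
    intro δ hδ
    obtain ⟨p, hp, hpφ⟩ := exists_mem_neumannAlg_near hφ hδ
    have hpc := continuous_of_mem_neumannAlg hp
    have e : ∫ x, g x * φ x ∂(volOmega n) = ∫ x, g x * φ x - g x * p x ∂(volOmega n) := by
      rw [integral_sub (hi hφ) (hi hpc), h0 p hp, sub_zero]
    rw [e, ← integral_const_mul]
    refine abs_integral_le_integral_abs.trans
      (integral_mono_ae ((hi hφ).sub (hi hpc)).abs (hg1.const_mul δ) ?_)
    filter_upwards [ae_mem_Omega n] with x hx
    rw [← mul_sub, abs_mul, mul_comm, abs_sub_comm]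
    exact mul_le_mul_of_nonneg_right (hpφ x (Ioo_subset_Icc_self hx)).le (abs_nonneg _)
  set I := ∫ x, |g x| ∂(volOmega n)
  have hI : 0 ≤ I := integral_nonneg fun _ => abs_nonneg _
  refine abs_eq_zero.1 (le_antisymm (le_of_forall_pos_le_add fun δ hδ => ?_) (abs_nonneg _))
  refine (hle (δ / (I + 1)) (by positivity)).trans ?_
  rw [zero_add, div_mul_eq_mul_div, div_le_iff₀ (by positivity)]
  nlinarith

theorem ae_eq_zero_of_neumannFun {n : ℕ} {g : Cyl n → ℝ} (hg : MemLp g 2 (volOmega n))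
    (h : ∀ c k m, ∫ x, g x * neumannFun c k m x ∂(volOmega n) = 0) :
    g =ᵐ[volOmega n] 0 := by
  have hd := BoundedContinuousFunction.toLp_denseRange (p := 2) (μ := volOmega n) (E := ℝ) ℝ
    (by norm_num)
  have hz : hg.toLp g = 0 := by
    refine hd.eq_zero_of_inner_left ℝ fun v => ?_
    rw [← integral_mul_eq_zero_of_neumannFun hg h v.continuous, L2.inner_def]
    refine integral_congr_ae ?_
    filter_upwards [hg.coeFn_toLp, BoundedContinuousFunction.coeFn_toLp 2 (volOmega n) ℝ v]
      with x h1 h2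
    rw [h1, h2]
    simp [mul_comm]
  have h0 := hg.coeFn_toLp
  rw [hz] at h0
  exact h0.symm.trans (Lp.coeFn_zero ℝ 2 _)

/-! ### Cutoff functions of the last variable -/

theorem deriv_smoothTransition_eq_zero {x : ℝ} (hx : x < 0 ∨ 1 < x) :
    deriv Real.smoothTransition x = 0 := by
  rcases hx with hx | hx
  · have : Real.smoothTransition =ᶠ[𝓝 x] fun _ => 0 := by
      filter_upwards [Iio_mem_nhds hx] with y hy
      exact Real.smoothTransition.zero_of_nonpos (le_of_lt hy)
    rw [this.deriv_eq, deriv_const]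
  · have : Real.smoothTransition =ᶠ[𝓝 x] fun _ => 1 := by
      filter_upwards [Ioi_mem_nhds hx] with y hy
      exact Real.smoothTransition.one_of_one_le (le_of_lt hy)
    rw [this.deriv_eq, deriv_const]

theorem exists_abs_deriv_smoothTransition_le :
    ∃ C, 0 ≤ C ∧ ∀ x, |deriv Real.smoothTransition x| ≤ C := by
  have hc : Continuous (deriv Real.smoothTransition) :=
    (Real.smoothTransition.contDiff (n := 1)).continuous_deriv le_rfl
  obtain ⟨C, hC⟩ := (isCompact_Icc (a := (0 : ℝ)) (b := 1)).exists_bound_of_continuousOn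
    hc.continuousOn
  refine ⟨max C 0, le_max_right _ _, fun x => ?_⟩
  by_cases hx : x ∈ Icc (0 : ℝ) 1
  · exact (hC x hx).trans (le_max_left _ _)
  · rw [deriv_smoothTransition_eq_zero, abs_zero]
    · exact le_max_right _ _
    · by_contra! h
      exact hx ⟨h.1, h.2⟩

/-- A smooth function of `t ∈ ℝ` with values in `[0, 1]`, equal to `0` where
`min (t, 1 - t) ≤ 1 / (j + 1)` and to `1` where `min (t, 1 - t) ≥ 2 / (j + 1)`. -/
def cutoff (j : ℕ) (t : ℝ) : ℝ :=
  Real.smoothTransition ((j + 1) * t - 1) * Real.smoothTransition ((j + 1) * (1 - t) - 1)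

theorem contDiff_cutoff (j : ℕ) : ContDiff ℝ ((⊤ : ℕ∞) : WithTop ℕ∞) (cutoff j) := by
  refine ContDiff.mul (Real.smoothTransition.contDiff.comp ?_)
    (Real.smoothTransition.contDiff.comp ?_) <;> fun_prop

theorem cutoff_nonneg (j : ℕ) (t : ℝ) : 0 ≤ cutoff j t :=
  mul_nonneg (Real.smoothTransition.nonneg _) (Real.smoothTransition.nonneg _)

theorem cutoff_le_one (j : ℕ) (t : ℝ) : cutoff j t ≤ 1 :=
  mul_le_one₀ (Real.smoothTransition.le_one _) (Real.smoothTransition.nonneg _)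
    (Real.smoothTransition.le_one _)

theorem cutoff_eq_zero {j : ℕ} {t : ℝ} (h : t ∉ Icc (1 / ((j : ℝ) + 1)) (1 - 1 / (j + 1))) :
    cutoff j t = 0 := by
  have hj : (0 : ℝ) < j + 1 := by positivity
  rw [mem_Icc, not_and_or, not_le, not_le] at h
  rcases h with h | h
  · rw [cutoff, Real.smoothTransition.zero_of_nonpos, zero_mul]
    rw [lt_div_iff₀ hj] at h
    linarith
  · rw [cutoff, mul_comm, Real.smoothTransition.zero_of_nonpos, zero_mul]
    have : 1 - t < 1 / (j + 1) := by linarith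
    rw [lt_div_iff₀ hj] at this
    linarith

theorem cutoff_eq_one {j : ℕ} {t : ℝ} (h : 2 ≤ (j + 1) * min t (1 - t)) : cutoff j t = 1 := by
  have hj : (0 : ℝ) < j + 1 := by positivity
  have h1 := mul_le_mul_of_nonneg_left (min_le_left t (1 - t)) hj.le
  have h2 := mul_le_mul_of_nonneg_left (min_le_right t (1 - t)) hj.le
  rw [cutoff, Real.smoothTransition.one_of_one_le (by linarith),
    Real.smoothTransition.one_of_one_le (by linarith), one_mul]

theorem deriv_cutoff (j : ℕ) (t : ℝ) : deriv (cutoff j) t =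
    (j + 1) * (deriv Real.smoothTransition ((j + 1) * t - 1) *
        Real.smoothTransition ((j + 1) * (1 - t) - 1) -
      Real.smoothTransition ((j + 1) * t - 1) *
        deriv Real.smoothTransition ((j + 1) * (1 - t) - 1)) := by
  have hd : ∀ x, HasDerivAt Real.smoothTransition (deriv Real.smoothTransition x) x := fun x =>
    ((Real.smoothTransition.contDiff (n := 1)).differentiable (by norm_num) x).hasDerivAt
  have l1 : HasDerivAt (fun t : ℝ => ((j : ℝ) + 1) * t - 1) (((j : ℝ) + 1) * 1) t :=
    ((hasDerivAt_id t).const_mul ((j : ℝ) + 1)).sub_const 1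
  have l2 : HasDerivAt (fun t : ℝ => ((j : ℝ) + 1) * (1 - t) - 1) (((j : ℝ) + 1) * (-1)) t :=
    (((hasDerivAt_id t).const_sub 1).const_mul ((j : ℝ) + 1)).sub_const 1
  have := ((hd _).comp t l1).mul ((hd _).comp t l2)
  refine this.deriv.trans ?_
  simp only [Function.comp_apply]
  ring

theorem deriv_cutoff_eq_zero {j : ℕ} {t : ℝ} (h : 2 < (j + 1) * min t (1 - t)) :
    deriv (cutoff j) t = 0 := by
  have hj : (0 : ℝ) < j + 1 := by positivity
  have h1 := mul_le_mul_of_nonneg_left (min_le_left t (1 - t)) hj.le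
  have h2 := mul_le_mul_of_nonneg_left (min_le_right t (1 - t)) hj.le
  rw [deriv_cutoff, deriv_smoothTransition_eq_zero (Or.inr (by linarith)),
    deriv_smoothTransition_eq_zero (Or.inr (by linarith))]
  ring

theorem exists_abs_deriv_cutoff_le :
    ∃ C, 0 ≤ C ∧ ∀ j t, |deriv (cutoff j) t| ≤ C * (j + 1) := by
  obtain ⟨C, hC0, hC⟩ := exists_abs_deriv_smoothTransition_le
  refine ⟨2 * C, by positivity, fun j t => ?_⟩
  have hs : ∀ x, |Real.smoothTransition x| ≤ 1 := fun x => by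
    rw [abs_of_nonneg (Real.smoothTransition.nonneg x)]
    exact Real.smoothTransition.le_one x
  have hj : (0 : ℝ) < j + 1 := by positivity
  rw [deriv_cutoff, abs_mul, abs_of_pos hj, mul_comm]
  refine mul_le_mul_of_nonneg_right ((abs_sub _ _).trans ?_) hj.le
  rw [abs_mul, abs_mul, two_mul]
  refine add_le_add ?_ ?_
  · exact (mul_le_of_le_one_right (abs_nonneg _) (hs _)).trans (hC _)
  · exact (mul_le_of_le_one_left (abs_nonneg _) (hs _)).trans (hC _)

theorem eventually_lt_mul_min {t : ℝ} (ht : t ∈ Ioo (0 : ℝ) 1) :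
    ∀ᶠ j : ℕ in atTop, 2 < ((j : ℝ) + 1) * min t (1 - t) := by
  have hm : 0 < min t (1 - t) := lt_min ht.1 (by linarith [ht.2])
  have h1 : Tendsto (fun j : ℕ => ((j : ℝ) + 1) * min t (1 - t)) atTop atTop :=
    (tendsto_atTop_add_const_right _ _ tendsto_natCast_atTop_atTop).atTop_mul_const hm
  exact h1.eventually_gt_atTop 2

theorem tendsto_cutoff {t : ℝ} (ht : t ∈ Ioo (0 : ℝ) 1) :
    Tendsto (fun j => cutoff j t) atTop (𝓝 1) :=
  tendsto_const_nhds.congr' ((eventually_lt_mul_min ht).mono fun _ h => (cutoff_eq_one h.le).symm)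

theorem isTest_cutoff_trigTensor {n : ℕ} (j : ℕ) (c : ℂ) (k : Fin n → ℤ) {h : ℝ → ℝ}
    (hh : ContDiff ℝ ((⊤ : ℕ∞) : WithTop ℕ∞) h) :
    IsTest (trigTensor c k fun t => cutoff j t * h t) := by
  have hj : (0 : ℝ) < 1 / (j + 1) := by positivity
  refine isTest_trigTensor c k ((contDiff_cutoff j).mul hh) hj (sub_lt_self 1 hj) fun t ht => ?_
  rw [cutoff_eq_zero ht, zero_mul]

/-- Multiplication by the cutoff functions does not change an integral in the limit. -/
theorem tendsto_integral_cutoff_mul {n : ℕ} {g : Cyl n → ℝ} (hg : Integrable g (volOmega n)) :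
    Tendsto (fun j => ∫ x, cutoff j x.2 * g x ∂(volOmega n)) atTop
      (𝓝 (∫ x, g x ∂(volOmega n))) := by
  refine tendsto_integral_of_dominated_convergence (fun x => |g x|) (fun j => ?_) hg.abs
    (fun j => ae_of_all _ fun x => ?_) ?_
  · exact ((contDiff_cutoff j).continuous.comp continuous_snd).aestronglyMeasurable.mul
      hg.aestronglyMeasurable
  · rw [Real.norm_eq_abs, abs_mul, abs_of_nonneg (cutoff_nonneg _ _)]
    exact mul_le_of_le_one_left (abs_nonneg _) (cutoff_le_one _ _)
  · filter_upwards [ae_mem_Omega n] with x hx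
    simpa using (tendsto_cutoff hx).mul_const (g x)

theorem deriv_cutoff_mul (j : ℕ) {h : ℝ → ℝ} (hh : Differentiable ℝ h) :
    deriv (fun t => cutoff j t * h t) =
      (fun t => cutoff j t * deriv h t) + fun t => deriv (cutoff j) t * h t := by
  funext t
  have h1 := (((contDiff_cutoff j).differentiable (by simp) t).hasDerivAt).mul (hh t).hasDerivAt
  refine h1.deriv.trans ?_
  simp only [Pi.add_apply]
  ring

/-- The boundary layer terms vanish in the limit for functions which vanish linearly at the
boundary. -/
theorem tendsto_integral_deriv_cutoff_mul {n : ℕ} {g w : Cyl n → ℝ}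
    (hg : Integrable g (volOmega n)) (hw : Continuous w) {M : ℝ}
    (hM : ∀ᵐ x ∂(volOmega n), |w x| ≤ M * min x.2 (1 - x.2)) :
    Tendsto (fun j => ∫ x, g x * (deriv (cutoff j) x.2 * w x) ∂(volOmega n)) atTop (𝓝 0) := by
  obtain ⟨C, hC0, hC⟩ := exists_abs_deriv_cutoff_le
  rw [← integral_zero (Cyl n) ℝ (μ := volOmega n)]
  refine tendsto_integral_of_dominated_convergence (fun x => |g x| * (2 * C * |M|)) (fun j => ?_)
    (hg.abs.mul_const _) (fun j => ?_) ?_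
  · refine hg.aestronglyMeasurable.mul (Continuous.aestronglyMeasurable ?_)
    exact (((contDiff_cutoff j).continuous_deriv (by simp)).comp continuous_snd).mul hw
  · filter_upwards [hM, ae_mem_Omega n] with x hx hx2
    have hm : 0 < min x.2 (1 - x.2) := lt_min hx2.1 (by linarith [hx2.2])
    rw [Real.norm_eq_abs, abs_mul]
    refine mul_le_mul_of_nonneg_left ?_ (abs_nonneg _)
    -- Either the point is outside the layer and the derivative vanishes, or `(j + 1) min (t, 1 - t)
    -- ≤ 2`, and the linear decay of `w` absorbs the slope `C (j + 1)`.
    rcases lt_or_ge 2 (((j : ℝ) + 1) * min x.2 (1 - x.2)) with h | h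
    · rw [deriv_cutoff_eq_zero h, zero_mul, abs_zero]
      positivity
    · rw [abs_mul]
      calc |deriv (cutoff j) x.2| * |w x|
          ≤ (C * (j + 1)) * (|M| * min x.2 (1 - x.2)) := by
            refine mul_le_mul (hC _ _) (hx.trans ?_) (abs_nonneg _) (by positivity)
            exact mul_le_mul_of_nonneg_right (le_abs_self M) hm.le
        _ = C * |M| * ((j + 1) * min x.2 (1 - x.2)) := by ring
        _ ≤ C * |M| * 2 := mul_le_mul_of_nonneg_left h (by positivity)
        _ = 2 * C * |M| := by ring
  · filter_upwards [ae_mem_Omega n] with x hx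
    refine tendsto_const_nhds.congr' ?_
    filter_upwards [eventually_lt_mul_min hx] with j hj
    rw [deriv_cutoff_eq_zero hj, zero_mul, mul_zero]

/-! ### Integration by parts against test functions -/

/-- The integral of a translate `φ(· + s e_i)` does not depend on `s`; differentiate under the
integral sign at `s = 0`. -/
theorem integral_pderiv_eq_zero {n : ℕ} {φ : Cyl n → ℝ} (hφ : IsTest φ) (i : Fin (n + 1)) :
    ∫ x, pderiv i φ x = 0 := by
  have hcs : HasCompactSupport (pderiv i φ) :=
    HasCompactSupport.intro hφ.2.1 fun x hx => pderiv_eq_zero i hx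
  have hpc := hφ.1.continuous_pderiv i
  obtain ⟨C, hC⟩ := hpc.bounded_above_of_compact_support hcs
  have hdir : |(dir i : (Fin n → ℝ) × ℝ).2| ≤ 1 := by
    induction i using Fin.lastCases <;> simp [dir]
  have hd : ∀ (x : Cyl n) (s : ℝ), HasDerivAt (fun s : ℝ => φ (x + cover (s • dir i)))
      (pderiv i φ (x + cover (s • dir i))) s := by
    intro x s
    obtain ⟨y, rfl⟩ := isOpenQuotientMap_cover.surjective x
    have h1 := hasDerivAt_slice hφ.1 i (y + s • dir i)
    rw [← pderiv_cover hφ.1, cover_add] at h1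
    rw [← sub_self s] at h1
    have h2 := h1.comp_sub_const s s
    refine h2.congr_of_eventuallyEq (Eventually.of_forall fun r => ?_)
    simp only
    have h3 : s • dir i + (r - s) • dir i = (r • dir i : (Fin n → ℝ) × ℝ) := by
      rw [← add_smul, add_sub_cancel]
    rw [add_assoc, ← cover_add (s • dir i), h3]
  have hcov : ∀ s : ℝ, Continuous fun x : Cyl n => x + cover (s • dir i) := fun s => by fun_prop
  -- For `|s| < 1` all the translates are supported in this slab, so a constant times its indicator
  -- dominates.
  have hK := isCompact_slab n (-1) 2
  have hcov0 : (cover 0 : Cyl n) = 0 := by ext <;> simp [cover]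
  have hinv : (volume : Measure (Cyl n)).IsAddRightInvariant :=
    Measure.prod.instIsAddRightInvariant
  have hder := hasDerivAt_integral_of_dominated_loc_of_deriv_le (μ := (volume : Measure (Cyl n)))
    (F := fun s x => φ (x + cover (s • dir i)))
    (F' := fun s x => pderiv i φ (x + cover (s • dir i))) (x₀ := (0 : ℝ))
    (s := Ioo (-1) 1)
    (bound := (univ ×ˢ Icc (-1 : ℝ) 2).indicator fun _ => C)
    (Ioo_mem_nhds (by norm_num) (by norm_num))
    (Eventually.of_forall fun s => (hφ.1.continuous.comp (hcov s)).aestronglyMeasurable)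
    ?_ (hpc.comp (hcov 0)).aestronglyMeasurable (ae_of_all _ fun x s hs => ?_)
    ((integrable_indicator_iff hK.measurableSet).2
      (integrableOn_const hK.measure_lt_top.ne)) (ae_of_all _ fun x s _ => hd x s)
  · have hc : (fun s : ℝ => ∫ x : Cyl n, φ (x + cover (s • dir i))) = fun _ => ∫ x, φ x :=
      funext fun s => integral_add_right_eq_self φ _
    have h1 := hder.2
    rw [hc] at h1
    simpa [hcov0] using h1.unique (hasDerivAt_const _ _)
  · simpa [hcov0] using hφ.1.continuous.integrable_of_hasCompactSupport hφ.2.1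
  · by_cases hx : x ∈ univ ×ˢ Icc (-1 : ℝ) 2
    · rw [indicator_of_mem hx]
      exact hC _
    · rw [indicator_of_notMem hx, pderiv_eq_zero, norm_zero]
      intro hmem
      have h1 : x.2 + s * (dir i : (Fin n → ℝ) × ℝ).2 ∈ Ioo (0 : ℝ) 1 := (hφ.2.2 hmem).2
      have h2 : |s * (dir i : (Fin n → ℝ) × ℝ).2| ≤ 1 := by
        rw [abs_mul]
        exact mul_le_one₀ (abs_le.2 ⟨hs.1.le, hs.2.le⟩) (abs_nonneg _) hdir
      have h3 := abs_le.1 h2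
      exact hx ⟨mem_univ _, by linarith [h1.1], by linarith [h1.2]⟩

/-- `ψ φ` is again a test function, so the integral of its derivative, expanded by the product rule,
is zero. -/
theorem IsSmooth.isWeakDeriv {n : ℕ} {ψ : Cyl n → ℝ} (hψ : IsSmooth ψ) (i : Fin (n + 1)) :
    IsWeakDeriv i ψ (pderiv i ψ) := by
  intro φ hφ
  have hprod : IsTest (fun x => ψ x * φ x) :=
    ⟨ContDiff.mul hψ hφ.1, hφ.2.1.mul_left, (tsupport_mul_subset_right).trans hφ.2.2⟩
  have hp : pderiv i (fun x => ψ x * φ x) = fun x => ψ x * pderiv i φ x + pderiv i ψ x * φ x := by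
    funext x
    obtain ⟨y, rfl⟩ := isOpenQuotientMap_cover.surjective x
    have h0 : (cover ((0 : ℝ) • dir i) : Cyl n) = 0 := by ext <;> simp [cover]
    rw [pderiv_cover hψ, pderiv_cover hφ.1]
    refine ((hasDerivAt_slice hψ i y).mul (hasDerivAt_slice hφ.1 i y)).deriv.trans ?_
    rw [h0, add_zero]
    ring
  have h0 := integral_pderiv_eq_zero hprod i
  have hout : ∀ x ∉ Omega n, pderiv i (fun x => ψ x * φ x) x = 0 := fun x hx =>
    pderiv_eq_zero i fun h => hx (hprod.2.2 h)
  rw [← setIntegral_eq_integral_of_forall_compl_eq_zero hout, hp] at h0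
  have h1 : Integrable (fun x => ψ x * pderiv i φ x) (volOmega n) :=
    hψ.continuous.memLp_volOmega.integrable_mul (hφ.memLp_pderiv i)
  have h2 : Integrable (fun x => pderiv i ψ x * φ x) (volOmega n) :=
    (hψ.continuous_pderiv i).memLp_volOmega.integrable_mul hφ.memLp
  rw [volOmega] at h1 h2 ⊢
  rw [integral_add h1 h2] at h0
  linarith

/-! ### Integration by parts against smooth functions with vanishing normal component -/

/-- The cutoff depends on the last variable only, so tangential derivatives create no boundary layer
and `b` needs no boundary condition. -/
theorem isWeakDeriv_integral_castSucc {n : ℕ} {j : Fin n} {u g : Cyl n → ℝ}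
    (hu : MemLp u 2 (volOmega n)) (hg : MemLp g 2 (volOmega n)) (h : IsWeakDeriv j.castSucc u g)
    (c : ℂ) (k : Fin n → ℤ) {b : ℝ → ℝ} (hb : ContDiff ℝ ((⊤ : ℕ∞) : WithTop ℕ∞) b) :
    ∫ x, u x * pderiv j.castSucc (trigTensor c k b) x ∂(volOmega n) =
      -∫ x, g x * trigTensor c k b x ∂(volOmega n) := by
  have hs := isSmooth_trigTensor c k hb
  have l := tendsto_integral_cutoff_mul
    (hu.integrable_mul (hs.continuous_pderiv j.castSucc).memLp_volOmega)
  have r := (tendsto_integral_cutoff_mul (hg.integrable_mul hs.continuous.memLp_volOmega)).neg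
  refine tendsto_nhds_unique (l.congr fun i => ?_) r
  have := h _ (isTest_cutoff_trigTensor i c k hb)
  simp only [pderiv_trigTensor_castSucc, trigTensor_mul] at this ⊢
  simpa only [Pi.mul_apply, mul_left_comm] using this

/-- Here the product rule produces a layer term with `deriv (cutoff i) * b`. The bound `hM` makes it
vanish in the limit; it will be applied to the sine arising as the derivative of a cosine. -/
theorem isWeakDeriv_integral_last {n : ℕ} {u g : Cyl n → ℝ}
    (hu : MemLp u 2 (volOmega n)) (hg : MemLp g 2 (volOmega n)) (h : IsWeakDeriv (Fin.last n) u g)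
    (c : ℂ) (k : Fin n → ℤ) {b : ℝ → ℝ} (hb : ContDiff ℝ ((⊤ : ℕ∞) : WithTop ℕ∞) b) {M : ℝ}
    (hM : ∀ t ∈ Ioo (0 : ℝ) 1, |b t| ≤ M * min t (1 - t)) :
    ∫ x, u x * pderiv (Fin.last n) (trigTensor c k b) x ∂(volOmega n) =
      -∫ x, g x * trigTensor c k b x ∂(volOmega n) := by
  have hs := isSmooth_trigTensor c k hb
  have hd := hb.differentiable (by simp)
  have hi := hu.integrable_mul (hs.continuous_pderiv (Fin.last n)).memLp_volOmega
  have l := tendsto_integral_cutoff_mul hi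
  have r := (tendsto_integral_cutoff_mul (hg.integrable_mul hs.continuous.memLp_volOmega)).neg
  have hbd : ∀ᵐ x ∂(volOmega n), |trigTensor c k b x| ≤ (‖c‖ * M) * min x.2 (1 - x.2) := by
    filter_upwards [ae_mem_Omega n] with x hx
    rw [trigTensor, abs_mul, mul_assoc]
    exact mul_le_mul (abs_re_mul_mFourier_le _ _ _) (hM _ hx) (abs_nonneg _) (norm_nonneg _)
  have z := tendsto_integral_deriv_cutoff_mul (hu.integrable (by norm_num)) hs.continuous hbd
  have lz := l.add z
  rw [add_zero] at lz
  refine tendsto_nhds_unique (lz.congr fun i => ?_) r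
  have := h _ (isTest_cutoff_trigTensor i c k hb)
  rw [pderiv_trigTensor_last _ _ ((contDiff_cutoff i).mul hb |>.differentiable (by simp)),
    deriv_cutoff_mul i hd] at this
  simp only [trigTensor_mul] at this
  have e : ∫ x, g x * (cutoff i x.2 * trigTensor c k b x) ∂(volOmega n) =
      ∫ x, cutoff i x.2 * (g * trigTensor c k b) x ∂(volOmega n) := by
    simp only [Pi.mul_apply, mul_left_comm]
  rw [e] at this
  rw [← this, ← integral_add]
  · refine integral_congr_ae (ae_of_all _ fun x => ?_)
    simp only [pderiv_trigTensor_last c k hd, Pi.mul_apply, trigTensor, Pi.add_apply]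
    ring
  · refine hi.bdd_mul (c := 1) ?_ (ae_of_all _ fun x => ?_)
    · exact ((contDiff_cutoff i).continuous.comp continuous_snd).aestronglyMeasurable
    · rw [Real.norm_eq_abs, abs_of_nonneg (cutoff_nonneg _ _)]
      exact cutoff_le_one _ _
  · refine hu.integrable_mul (Continuous.memLp_volOmega ?_)
    exact (((contDiff_cutoff i).continuous_deriv (by simp)).comp continuous_snd).mul hs.continuous

theorem deriv_cos_mul (m : ℤ) : deriv (fun t : ℝ => Real.cos (m * Real.pi * t)) =
    fun t => -(m * Real.pi) * Real.sin (m * Real.pi * t) := by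
  funext t
  have := ((hasDerivAt_id t).const_mul (m * Real.pi)).cos
  refine this.deriv.trans ?_
  simp only [id, mul_one]
  ring

/-- A quantitative form of the Neumann condition for `cos (mπt)`. The endpoint `1` reduces to `0`
under `t ↦ 1 - t`, since `|cos (mπ)| = 1`. -/
theorem abs_sin_int_mul_pi_mul_le (m : ℤ) {t : ℝ} (ht : t ∈ Ioo (0 : ℝ) 1) :
    |Real.sin (m * Real.pi * t)| ≤ |m * Real.pi| * min t (1 - t) := by
  rcases min_cases t (1 - t) with ⟨h, -⟩ | ⟨h, -⟩
  · rw [h]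
    refine Real.abs_sin_le_abs.trans_eq ?_
    rw [abs_mul, abs_of_pos ht.1]
  · have e : |Real.sin (m * Real.pi * t)| = |Real.sin (m * Real.pi * (1 - t))| := by
      rw [mul_one_sub, Real.sin_sub, Real.sin_int_mul_pi, zero_mul, zero_sub, abs_neg, abs_mul,
        Real.abs_cos_int_mul_pi, one_mul]
    rw [h, e]
    refine Real.abs_sin_le_abs.trans_eq ?_
    rw [abs_mul, abs_of_pos (sub_pos.2 ht.2)]

theorem trigTensor_ofReal_mul {n : ℕ} (r : ℝ) (c : ℂ) (k : Fin n → ℤ) (h : ℝ → ℝ) (x : Cyl n) :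
    trigTensor (r * c) k h x = r * trigTensor c k h x := by
  simp only [trigTensor, mul_assoc, Complex.re_ofReal_mul]

/-- Green's formula for an `H¹` function and a Neumann eigenfunction, one direction at a time. -/
theorem exists_integral_mul_pderiv_neumannFun {n : ℕ} (c : ℂ) (k : Fin n → ℤ) (m : ℤ)
    (i : Fin (n + 1)) : ∃ l : ℝ, 0 ≤ l ∧ ∀ u g : Cyl n → ℝ, MemLp u 2 (volOmega n) →
      MemLp g 2 (volOmega n) → IsWeakDeriv i u g →
        ∫ x, g x * pderiv i (neumannFun c k m) x ∂(volOmega n) =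
          l * ∫ x, u x * neumannFun c k m x ∂(volOmega n) := by
  have hcos := contDiff_cos_mul m
  induction i using Fin.lastCases with
  | last =>
    refine ⟨(m * Real.pi) ^ 2, by positivity, fun u g hu hg h => ?_⟩
    have hsin : ContDiff ℝ ((⊤ : ℕ∞) : WithTop ℕ∞)
        (fun t : ℝ => -(m * Real.pi) * Real.sin (m * Real.pi * t)) :=
      contDiff_const.mul (Real.contDiff_sin.comp (contDiff_const.mul contDiff_id))
    have hb : ∀ t ∈ Ioo (0 : ℝ) 1, |-(m * Real.pi) * Real.sin (m * Real.pi * t)| ≤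
        |m * Real.pi| * |m * Real.pi| * min t (1 - t) := fun t ht => by
      rw [abs_mul, abs_neg, mul_assoc |(m : ℝ) * Real.pi|]
      exact mul_le_mul_of_nonneg_left (abs_sin_int_mul_pi_mul_le m ht) (abs_nonneg _)
    -- The integration by parts is applied to the derivative of the eigenfunction, whose vertical
    -- factor is a sine; differentiating once more returns the eigenfunction times `-(mπ)²`.
    have key := isWeakDeriv_integral_last hu hg h c k hsin hb
    have hdd : deriv (fun t : ℝ => -(m * Real.pi) * Real.sin (m * Real.pi * t)) =
        fun t => -(m * Real.pi) ^ 2 * Real.cos (m * Real.pi * t) := by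
      funext t
      have := (((hasDerivAt_id t).const_mul (m * Real.pi)).sin).const_mul (-(m * Real.pi))
      refine this.deriv.trans ?_
      simp only [id, mul_one]
      ring
    rw [neumannFun, pderiv_trigTensor_last c k (hcos.differentiable (by simp)), deriv_cos_mul,
      ← neg_eq_iff_eq_neg.2 key, ← integral_const_mul,
      pderiv_trigTensor_last c k (hsin.differentiable (by simp)), hdd, ← integral_neg]
    refine integral_congr_ae (ae_of_all _ fun x => ?_)
    simp only [trigTensor]
    ring
  | cast j =>
    refine ⟨(2 * Real.pi * k j) ^ 2, by positivity, fun u g hu hg h => ?_⟩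
    have key := isWeakDeriv_integral_castSucc hu hg h (2 * Real.pi * Complex.I * k j * c) k hcos
    rw [neumannFun, pderiv_trigTensor_castSucc, ← neg_eq_iff_eq_neg.2 key, ← integral_const_mul,
      pderiv_trigTensor_castSucc, ← integral_neg]
    refine integral_congr_ae (ae_of_all _ fun x => ?_)
    have : 2 * Real.pi * Complex.I * k j * (2 * Real.pi * Complex.I * k j * c) =
        ((-(2 * Real.pi * k j) ^ 2 : ℝ) : ℂ) * c := by
      push_cast
      linear_combination (2 * Real.pi * k j) ^ 2 * c * Complex.I_mul_I
    simp only [this, trigTensor_ofReal_mul]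
    ring

/-! ### Density of the Neumann eigenfunctions in `H¹(Ω)` -/

/-- The element `(ψ, ∇ψ)` of `H¹(Ω)` given by a smooth function `ψ`. -/
def IsSmooth.jet {n : ℕ} {ψ : Cyl n → ℝ} (hψ : IsSmooth ψ) : Jet n :=
  WithLp.toLp 2 fun o => o.elim (hψ.continuous.memLp_volOmega.toLp ψ)
    fun i => (hψ.continuous_pderiv i).memLp_volOmega.toLp (pderiv i ψ)

theorem IsSmooth.jet_mem {n : ℕ} {ψ : Cyl n → ℝ} (hψ : IsSmooth ψ) : hψ.jet ∈ H1 n := by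
  intro i φ hφ
  have h0 := hψ.continuous.memLp_volOmega.coeFn_toLp
  have h1 := (hψ.continuous_pderiv i).memLp_volOmega.coeFn_toLp
  have l : ∫ x, hψ.jet none x * pderiv i φ x ∂(volOmega n) =
      ∫ x, ψ x * pderiv i φ x ∂(volOmega n) := by
    refine integral_congr_ae ?_
    filter_upwards [h0] with x hx
    exact congrArg (· * _) hx
  have r : ∫ x, hψ.jet (some i) x * φ x ∂(volOmega n) =
      ∫ x, pderiv i ψ x * φ x ∂(volOmega n) := by
    refine integral_congr_ae ?_
    filter_upwards [h1] with x hx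
    exact congrArg (· * _) hx
  rw [l, r]
  exact hψ.isWeakDeriv i φ hφ

theorem IsSmooth.inner_jet {n : ℕ} {ψ : Cyl n → ℝ} (hψ : IsSmooth ψ) (v : Jet n) :
    inner ℝ v hψ.jet = ∫ x, v none x * ψ x ∂(volOmega n) +
      ∑ i, ∫ x, v (some i) x * pderiv i ψ x ∂(volOmega n) := by
  rw [PiLp.inner_apply, Fintype.sum_option]
  simp only [integral_mul_eq_inner _ hψ.continuous.memLp_volOmega,
    integral_mul_eq_inner _ (hψ.continuous_pderiv _).memLp_volOmega]
  rfl

/-- Each defining identity equates inner products with fixed `L²` functions, which are continuous in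
the jet. -/
theorem isClosed_H1 (n : ℕ) : IsClosed (H1 n : Set (Jet n)) := by
  have e : (H1 n : Set (Jet n)) = ⋂ (i : Fin (n + 1)) (φ : Cyl n → ℝ) (_ : IsTest φ),
      {v : Jet n | ∫ x, v none x * pderiv i φ x ∂(volOmega n) =
        -∫ x, v (some i) x * φ x ∂(volOmega n)} := by
    ext v
    simp only [mem_iInter]
    rfl
  rw [e]
  refine isClosed_iInter fun i => isClosed_iInter fun φ => isClosed_iInter fun hφ => ?_
  simp only [integral_mul_eq_inner _ (hφ.memLp_pderiv i), integral_mul_eq_inner _ hφ.memLp]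
  refine isClosed_eq ?_ ?_ <;> fun_prop

/-- By Green's formula the inner product is `(1 + ∑ l i) ∫ v ψ` with all `l i ≥ 0`, so `v` is
`L²`-orthogonal to a complete system. -/
theorem eq_zero_of_inner_neumannFun {n : ℕ} {v : Jet n} (hv : v ∈ H1 n)
    (h : ∀ c k m, inner ℝ v (isSmooth_neumannFun (n := n) c k m).jet = 0) : v = 0 := by
  have h0 : v none =ᵐ[volOmega n] 0 := by
    refine ae_eq_zero_of_neumannFun (Lp.memLp _) fun c k m => ?_
    have h1 := h c k m
    choose l hl hl' using exists_integral_mul_pderiv_neumannFun c k m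
    have hl1 : ∀ i, ∫ x, v (some i) x * pderiv i (neumannFun c k m) x ∂(volOmega n) =
        l i * ∫ x, v none x * neumannFun c k m x ∂(volOmega n) := fun i =>
      hl' i _ _ (Lp.memLp _) (Lp.memLp _) (hv i)
    simp only [IsSmooth.inner_jet, hl1] at h1
    rw [← Finset.sum_mul, ← one_add_mul] at h1
    have hs : 0 ≤ ∑ i, l i := Finset.sum_nonneg fun i _ => hl i
    exact (mul_eq_zero.1 h1).resolve_left (by positivity)
  have hi : ∀ i, v (some i) =ᵐ[volOmega n] 0 := by
    intro i
    -- The weak gradient of a null function is null. The cutoff turns eigenfunctions into test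
    -- functions, so completeness applies to `cutoff j * v (some i)`; at each point of `Ω` some
    -- cutoff equals `1`.
    have hj : ∀ j : ℕ, (fun x => cutoff j x.2 * v (some i) x) =ᵐ[volOmega n] 0 := by
      intro j
      refine ae_eq_zero_of_neumannFun ?_ fun c k m => ?_
      · refine (Lp.memLp (v (some i))).of_le ?_ (ae_of_all _ fun x => ?_)
        · exact ((contDiff_cutoff j).continuous.comp
            continuous_snd).aestronglyMeasurable.mul (Lp.aestronglyMeasurable _)
        · rw [norm_mul, Real.norm_eq_abs, abs_of_nonneg (cutoff_nonneg _ _)]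
          exact mul_le_of_le_one_left (norm_nonneg _) (cutoff_le_one _ _)
      · have h2 := hv i _ (isTest_cutoff_trigTensor j c k (contDiff_cos_mul m))
        have h3 : ∀ φ : Cyl n → ℝ, ∫ x, v none x * φ x ∂(volOmega n) = 0 := fun φ => by
          refine integral_eq_zero_of_ae ?_
          filter_upwards [h0] with x hx
          simp [hx]
        rw [h3, eq_comm, neg_eq_zero] at h2
        rw [← h2]
        refine integral_congr_ae (ae_of_all _ fun x => ?_)
        simp only [trigTensor_mul, neumannFun]
        ring
    filter_upwards [ae_all_iff.2 hj, ae_mem_Omega n] with x hx hx2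
    obtain ⟨j, hj⟩ := (eventually_lt_mul_min hx2).exists
    have := hx j
    simp only [cutoff_eq_one hj.le] at this
    simpa using this
  ext1 o
  cases o with
  | none => exact Lp.ext (h0.trans (Lp.coeFn_zero ℝ 2 _).symm)
  | some i => exact Lp.ext ((hi i).trans (Lp.coeFn_zero ℝ 2 _).symm)

/-- Density in dual form. The jet `w` need not belong to `H1 n`. The part of `v` orthogonal to the
closed span of the eigenfunctions is itself in `H1 n`, hence zero. -/
theorem inner_eq_zero_of_neumannFun {n : ℕ} {w : Jet n}
    (hw : ∀ c k m, inner ℝ w (isSmooth_neumannFun (n := n) c k m).jet = 0)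
    {v : Jet n} (hv : v ∈ H1 n) : inner ℝ w v = 0 := by
  set S : Submodule ℝ (Jet n) :=
    Submodule.span ℝ {z | ∃ c k m, z = (isSmooth_neumannFun (n := n) c k m).jet}
  have hS : ∀ c k m, (isSmooth_neumannFun (n := n) c k m).jet ∈ S :=
    fun c k m => Submodule.subset_span ⟨c, k, m, rfl⟩
  have hSH : S.topologicalClosure ≤ H1 n := by
    refine S.topologicalClosure_minimal (Submodule.span_le.2 ?_) (isClosed_H1 n)
    rintro _ ⟨c, k, m, rfl⟩
    exact IsSmooth.jet_mem _
  have : CompleteSpace S.topologicalClosure :=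
    S.isClosed_topologicalClosure.completeSpace_coe
  obtain ⟨y, hy, z, hz, rfl⟩ := S.topologicalClosure.exists_add_mem_mem_orthogonal v
  have hz0 : z = 0 := by
    refine eq_zero_of_inner_neumannFun ?_ fun c k m => ?_
    · simpa using sub_mem hv (hSH hy)
    · exact (Submodule.mem_orthogonal' _ _).1 hz _ (S.le_topologicalClosure (hS c k m))
  have hwS : w ∈ S.topologicalClosureᗮ := by
    rw [Submodule.orthogonal_closure, Submodule.mem_orthogonal']
    intro u hu
    refine Submodule.span_induction (p := fun u _ => inner ℝ w u = 0) ?_ (inner_zero_right _)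
      ?_ ?_ hu
    · rintro _ ⟨c, k, m, rfl⟩
      exact hw c k m
    · intro a b _ _ ha hb
      rw [inner_add_right, ha, hb, add_zero]
    · intro r a _ ha
      rw [inner_smul_right, ha, mul_zero]
  rw [hz0, add_zero]
  exact (Submodule.mem_orthogonal' _ _).1 hwS _ hy

/-! ### Integrability of the flux -/

theorem continuous_weight {n : ℕ} (ε : ℝ) : Continuous (weight (n := n) ε) :=
  ((Metric.continuous_infDist_pt _).div_const ε).min continuous_const

theorem weight_nonneg {n : ℕ} {ε : ℝ} (hε : 0 < ε) (x : Cyl n) : 0 ≤ weight ε x :=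
  le_min (div_nonneg Metric.infDist_nonneg hε.le) zero_le_one

theorem weight_le_one {n : ℕ} (ε : ℝ) (x : Cyl n) : weight ε x ≤ 1 :=
  min_le_right _ _

theorem weight_le {n : ℕ} (ε : ℝ) {x : Cyl n} (hx : x.2 ∈ Ioo (0 : ℝ) 1) :
    weight ε x ≤ min x.2 (1 - x.2) / ε := by
  rw [← distBdry_eq ⟨mem_univ _, hx⟩]
  exact min_le_left _ _

theorem MemL2loc.aestronglyMeasurable {n : ℕ} {g : Cyl n → ℝ} (hg : MemL2loc g) :
    AEStronglyMeasurable g (volOmega n) := by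
  have hU : Omega n = ⋃ j : ℕ, univ ×ˢ Icc (1 / ((j : ℝ) + 1)) (1 - 1 / (j + 1)) := by
    ext x
    simp only [Omega, mem_iUnion, mem_prod, mem_univ, true_and]
    constructor
    · intro hx
      obtain ⟨j, hj⟩ := (eventually_lt_mul_min hx).exists
      refine ⟨j, ?_⟩
      -- The cutoff vanishes off the slab but equals `1` at `x` for this `j`, so `x` lies in the
      -- slab.
      by_contra h
      have h1 := cutoff_eq_one hj.le
      rw [cutoff_eq_zero h] at h1
      exact zero_ne_one h1
    · rintro ⟨j, hj⟩
      have : (0 : ℝ) < 1 / (j + 1) := by positivity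
      exact ⟨this.trans_le hj.1, by linarith [hj.2]⟩
  rw [volOmega, hU]
  refine AEStronglyMeasurable.iUnion fun j => ?_
  refine (hg _ (isCompact_slab n _ _) ?_).aestronglyMeasurable
  rw [hU]
  exact subset_iUnion (fun j : ℕ => univ ×ˢ Icc (1 / ((j : ℝ) + 1)) (1 - 1 / (j + 1))) j

theorem memLp_sqrt_weight_mul_weakGrad {n : ℕ} {ε : ℝ} (hε : 0 < ε) {u : Cyl n → ℝ}
    (hE : energy ε u < ⊤) (i : Fin (n + 1)) :
    MemLp (fun x => √(weight ε x) * weakGrad u i x) 2 (volOmega n) := by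
  have hu : MemH1loc u := by
    by_contra h
    simp [energy, h] at hE
  have hG : IsWeakGrad u (weakGrad u) := by
    rw [weakGrad, dif_pos hu]
    exact hu.2.choose_spec
  have hm : ∀ i, AEStronglyMeasurable (weakGrad u i) (volOmega n) :=
    fun i => (hG i).1.aestronglyMeasurable
  have hwm := (continuous_weight (n := n) ε).aestronglyMeasurable (μ := volOmega n)
  have hint : Integrable (fun x => weight ε x * ∑ i, weakGrad u i x ^ 2) (volOmega n) := by
    refine ⟨hwm.mul (Finset.aestronglyMeasurable_fun_sum _ fun i _ => (hm i).pow 2), ?_⟩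
    rw [hasFiniteIntegral_iff_ofReal (ae_of_all _ fun x =>
      mul_nonneg (weight_nonneg hε x) (Finset.sum_nonneg fun i _ => sq_nonneg _))]
    rw [energy, if_pos hu] at hE
    by_contra h
    rw [not_lt, top_le_iff] at h
    rw [h] at hE
    simp [ENNReal.mul_top] at hE
  have hs := (continuous_weight (n := n) ε).sqrt.aestronglyMeasurable (μ := volOmega n)
  refine (memLp_two_iff_integrable_sq (hs.mul (hm i))).2 ?_
  refine hint.mono ((hs.mul (hm i)).pow 2) (ae_of_all _ fun x => ?_)
  rw [Real.norm_eq_abs, abs_of_nonneg (sq_nonneg _), Pi.mul_apply, mul_pow,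
    Real.sq_sqrt (weight_nonneg hε x)]
  refine le_trans ?_ (le_abs_self _)
  exact mul_le_mul_of_nonneg_left (Finset.single_le_sum (f := fun i => weakGrad u i x ^ 2)
    (fun i _ => sq_nonneg _) (Finset.mem_univ i)) (weight_nonneg hε x)

/-- One factor `√a` makes the gradient square integrable; the other is kept to offset the derivative
of the cutoff. -/
theorem flux_eq {n : ℕ} {ε : ℝ} (hε : 0 < ε) (u : Cyl n → ℝ) (i : Fin (n + 1)) (x : Cyl n) :
    flux ε u i x = √(weight ε x) * (√(weight ε x) * weakGrad u i x) := by
  rw [← mul_assoc, Real.mul_self_sqrt (weight_nonneg hε x), flux]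

theorem memLp_flux {n : ℕ} {ε : ℝ} (hε : 0 < ε) {u : Cyl n → ℝ}
    (hE : energy ε u < ⊤) (i : Fin (n + 1)) : MemLp (flux ε u i) 2 (volOmega n) := by
  have h := memLp_sqrt_weight_mul_weakGrad hε hE i
  have e : flux ε u i = fun x => √(weight ε x) * (√(weight ε x) * weakGrad u i x) :=
    funext (flux_eq hε u i)
  rw [e]
  refine h.of_le ?_ (ae_of_all _ fun x => ?_)
  · exact (continuous_weight ε).sqrt.aestronglyMeasurable.mul h.aestronglyMeasurable
  · rw [norm_mul, Real.norm_eq_abs, abs_of_nonneg (Real.sqrt_nonneg _)]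
    exact mul_le_of_le_one_left (norm_nonneg _) (Real.sqrt_le_one.2 (weight_le_one ε x))

/-! ### The boundary layer -/

/-- If `A j` is bounded in `L²` and vanishes eventually at almost every point, then it converges
weakly to `0` in `L²`. -/
theorem tendsto_integral_mul_zero_of_bounded {α : Type*} [MeasurableSpace α] {μ : Measure α}
    {G : α → ℝ} (hG : MemLp G 2 μ) {A : ℕ → α → ℝ} (hm : ∀ j, Measurable (A j))
    (hA : ∀ j, MemLp (A j) 2 μ) {B : ℝ} (hB : ∀ j, ∫ x, A j x ^ 2 ∂μ ≤ B)
    (h0 : ∀ᵐ x ∂μ, ∀ᶠ j in atTop, A j x = 0) :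
    Tendsto (fun j => ∫ x, G x * A j x ∂μ) atTop (𝓝 0) := by
  have hG2 : Integrable (fun x => G x ^ 2) μ := hG.integrable_sq
  have hs : ∀ j, MeasurableSet {x | A j x ≠ 0} := fun j =>
    (measurableSet_eq_fun (hm j) measurable_const).compl
  have hI : Tendsto (fun j => ∫ x, {x | A j x ≠ 0}.indicator (fun x => G x ^ 2) x ∂μ) atTop
      (𝓝 0) := by
    suffices h : Tendsto (fun j => ∫ x, {x | A j x ≠ 0}.indicator (fun x => G x ^ 2) x ∂μ) atTop
        (𝓝 (∫ _, (0 : ℝ) ∂μ)) by rwa [integral_zero] at h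
    refine tendsto_integral_of_dominated_convergence (fun x => G x ^ 2)
      (fun j => hG2.aestronglyMeasurable.indicator (hs j)) hG2
      (fun j => ae_of_all _ fun x => ?_) ?_
    · refine (norm_indicator_le_norm_self _ _).trans_eq ?_
      rw [Real.norm_eq_abs, abs_of_nonneg (sq_nonneg _)]
    · filter_upwards [h0] with x hx
      refine tendsto_const_nhds.congr' (hx.mono fun j hj => ?_)
      exact (indicator_of_notMem (by simpa using hj) _).symm
  have hB0 : 0 ≤ B := (integral_nonneg fun x => sq_nonneg (A 0 x)).trans (hB 0)
  -- Young's inequality, with `G` restricted to the set where `A j ≠ 0`: the first term is small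
  -- with `δ`, the second tends to `0` for fixed `δ` by dominated convergence.
  have hle : ∀ δ > 0, ∀ j, |∫ x, G x * A j x ∂μ| ≤
      δ * B + δ⁻¹ * ∫ x, {x | A j x ≠ 0}.indicator (fun x => G x ^ 2) x ∂μ := by
    intro δ hδ j
    have i1 : Integrable (fun x => δ * A j x ^ 2) μ := (hA j).integrable_sq.const_mul δ
    have i2 : Integrable (fun x => δ⁻¹ * {x | A j x ≠ 0}.indicator (fun x => G x ^ 2) x) μ :=
      (hG2.indicator (hs j)).const_mul _
    calc |∫ x, G x * A j x ∂μ|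
        ≤ ∫ x, |G x * A j x| ∂μ := abs_integral_le_integral_abs
      _ ≤ ∫ x, δ * A j x ^ 2 + δ⁻¹ * {x | A j x ≠ 0}.indicator (fun x => G x ^ 2) x ∂μ := by
          refine integral_mono (hG.integrable_mul (hA j)).abs (i1.add i2) fun x => ?_
          by_cases hx : A j x = 0
          · simp [hx]
          · have hx' : x ∈ {x | A j x ≠ 0} := hx
            simp only [indicator_of_mem hx']
            have h1 : 0 ≤ δ⁻¹ * (|G x| - δ * |A j x|) ^ 2 := by positivity
            have h2 : δ⁻¹ * (|G x| - δ * |A j x|) ^ 2 =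
                δ⁻¹ * G x ^ 2 - 2 * |G x * A j x| + δ * A j x ^ 2 := by
              rw [abs_mul, ← sq_abs (G x), ← sq_abs (A j x)]
              field_simp
              ring
            linarith [abs_nonneg (G x * A j x)]
      _ = δ * ∫ x, A j x ^ 2 ∂μ +
          δ⁻¹ * ∫ x, {x | A j x ≠ 0}.indicator (fun x => G x ^ 2) x ∂μ := by
          rw [integral_add i1 i2, integral_const_mul, integral_const_mul]
      _ ≤ _ := by
          gcongr
          exact hB j
  rw [Metric.tendsto_atTop]
  intro e he
  -- Using `B + 1` gives `δ * B < e / 2` even when `B = 0`.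
  set δ := e / (2 * (B + 1))
  have hδ : 0 < δ := by positivity
  have hδB : δ * B < e / 2 := by
    rw [div_mul_eq_mul_div, div_lt_div_iff₀ (by positivity) (by norm_num)]
    nlinarith
  have hI' := hI.const_mul δ⁻¹
  rw [mul_zero] at hI'
  obtain ⟨N, hN⟩ := eventually_atTop.1 (hI'.eventually_lt_const (half_pos he))
  refine ⟨N, fun j hj => ?_⟩
  rw [Real.dist_eq, sub_zero]
  linarith [hle δ hδ j, hN j hj]

theorem measureReal_layer_le (n : ℕ) {r : ℝ} (hr : 0 ≤ r) :
    (volOmega n).real {x | min x.2 (1 - x.2) ≤ r} ≤ 2 * r := by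
  have hsub : {x : Cyl n | min x.2 (1 - x.2) ≤ r} ∩ Omega n ⊆
      univ ×ˢ (Icc 0 r ∪ Icc (1 - r) 1) := by
    rintro x ⟨hx, -, hx0, hx1⟩
    refine ⟨mem_univ _, ?_⟩
    rcases min_le_iff.1 (show min x.2 (1 - x.2) ≤ r from hx) with h | h
    · exact Or.inl ⟨hx0.le, h⟩
    · exact Or.inr ⟨by linarith, hx1.le⟩
  have hms : MeasurableSet {x : Cyl n | min x.2 (1 - x.2) ≤ r} := by
    refine measurableSet_le ?_ measurable_const
    fun_prop
  have h1 : volOmega n {x | min x.2 (1 - x.2) ≤ r} ≤ ENNReal.ofReal (2 * r) := by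
    rw [volOmega, Measure.restrict_apply hms]
    refine (measure_mono hsub).trans ?_
    rw [Measure.volume_eq_prod, Measure.prod_prod, measure_univ, one_mul, two_mul,
      ENNReal.ofReal_add hr hr]
    refine (measure_union_le _ _).trans_eq ?_
    rw [Real.volume_Icc, Real.volume_Icc, sub_zero, sub_sub_cancel]
  exact ENNReal.toReal_le_of_le_ofReal (by positivity) h1

/-- The heart of the argument: linear degeneracy of the weight is just enough to bound `√a η_j' ψ`
in `L²`, and weak convergence to `0` replaces any decay in norm. -/
theorem tendsto_integral_flux_deriv_cutoff {n : ℕ} {ε : ℝ} (hε : 0 < ε) {u : Cyl n → ℝ}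
    (hE : energy ε u < ⊤) (i : Fin (n + 1)) {ψ : Cyl n → ℝ} (hψ : Continuous ψ) :
    Tendsto (fun j => ∫ x, flux ε u i x * (deriv (cutoff j) x.2 * ψ x) ∂(volOmega n)) atTop
      (𝓝 0) := by
  obtain ⟨M, hM0, hM⟩ := exists_bound_of_continuous hψ
  obtain ⟨C, hC0, hC⟩ := exists_abs_deriv_cutoff_le
  have hAc : ∀ j, Continuous fun x : Cyl n => √(weight ε x) * (deriv (cutoff j) x.2 * ψ x) :=
    fun j => (continuous_weight ε).sqrt.mul
      ((((contDiff_cutoff j).continuous_deriv (by simp)).comp continuous_snd).mul hψ)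
  refine (tendsto_integral_mul_zero_of_bounded (memLp_sqrt_weight_mul_weakGrad hε hE i)
    (A := fun j x => √(weight ε x) * (deriv (cutoff j) x.2 * ψ x))
    -- On the layer `a ≤ 2 / ((j + 1) ε)` and `(η_j' ψ)² ≤ (C (j + 1) M)²`, while the layer has
    -- measure at most `4 / (j + 1)`; the powers of `j + 1` cancel.
    (B := 8 * (C * M) ^ 2 / ε) (fun j => (hAc j).measurable)
    (fun j => (hAc j).memLp_volOmega) (fun j => ?_) ?_).congr fun j => ?_
  · have hj : (0 : ℝ) < j + 1 := by positivity
    set L : Set (Cyl n) := {x | min x.2 (1 - x.2) ≤ 2 / (j + 1)}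
    have hL : MeasurableSet L := by
      refine measurableSet_le ?_ measurable_const
      fun_prop
    set b : ℝ := 2 * (C * M) ^ 2 / ε * (j + 1)
    have hb : 0 ≤ b := by positivity
    have hle : ∀ᵐ x ∂(volOmega n), (√(weight ε x) * (deriv (cutoff j) x.2 * ψ x)) ^ 2 ≤
        L.indicator (fun _ => b) x := by
      filter_upwards [ae_mem_Omega n] with x hx
      by_cases hxL : x ∈ L
      · rw [indicator_of_mem hxL, mul_pow, Real.sq_sqrt (weight_nonneg hε x)]
        have h1 : weight ε x ≤ 2 / (j + 1) / ε :=
          (weight_le ε hx).trans (div_le_div_of_nonneg_right hxL hε.le)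
        have h2 : |deriv (cutoff j) x.2 * ψ x| ≤ C * (j + 1) * M := by
          rw [abs_mul]
          exact mul_le_mul (hC _ _) (hM x (Ioo_subset_Icc_self hx)) (abs_nonneg _) (by positivity)
        have h3 : (deriv (cutoff j) x.2 * ψ x) ^ 2 ≤ (C * (j + 1) * M) ^ 2 := by
          rw [← sq_abs]
          exact pow_le_pow_left₀ (abs_nonneg _) h2 2
        refine (mul_le_mul h1 h3 (sq_nonneg _) (by positivity)).trans_eq ?_
        simp only [b]
        field_simp
      · rw [indicator_of_notMem hxL]
        have : 2 / ((j : ℝ) + 1) < min x.2 (1 - x.2) := not_le.1 hxL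
        rw [div_lt_iff₀' hj] at this
        rw [deriv_cutoff_eq_zero this]
        simp
    refine (integral_mono_ae (hAc j).memLp_volOmega.integrable_sq
      ((integrable_const b).indicator hL) hle).trans ?_
    rw [integral_indicator_const b hL, smul_eq_mul]
    refine (mul_le_mul_of_nonneg_right (measureReal_layer_le n (by positivity)) hb).trans_eq ?_
    simp only [b]
    field_simp
    ring
  · filter_upwards [ae_mem_Omega n] with x hx
    filter_upwards [eventually_lt_mul_min hx] with j hj
    rw [deriv_cutoff_eq_zero hj, zero_mul, mul_zero]
  · refine integral_congr_ae (ae_of_all _ fun x => ?_)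
    simp only [flux_eq hε]
    ring

/-! ### The normal trace of the flux -/

/-- Only the last direction differentiates the cutoff, so there is a single layer term. It vanishes
because the weight degenerates, with no boundary condition on `b`. -/
theorem integral_flux_mul_pderiv_trigTensor {n : ℕ} {ε : ℝ} (hε : 0 < ε) {u f : Cyl n → ℝ}
    (hE : energy ε u < ⊤) (hf : MemLp f 2 (volOmega n)) (hdiv : HasWeakDiv (flux ε u) f)
    (c : ℂ) (k : Fin n → ℤ) {b : ℝ → ℝ} (hb : ContDiff ℝ ((⊤ : ℕ∞) : WithTop ℕ∞) b) :
    ∫ x, ∑ i, flux ε u i x * pderiv i (trigTensor c k b) x ∂(volOmega n) =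
      -∫ x, f x * trigTensor c k b x ∂(volOmega n) := by
  have hs := isSmooth_trigTensor c k hb
  have hd := hb.differentiable (by simp)
  have hi : Integrable (fun x => ∑ i, flux ε u i x * pderiv i (trigTensor c k b) x)
      (volOmega n) := integrable_finsetSum _ fun i _ =>
    (memLp_flux hε hE i).integrable_mul (hs.continuous_pderiv i).memLp_volOmega
  have l := tendsto_integral_cutoff_mul hi
  have r := (tendsto_integral_cutoff_mul (hf.integrable_mul hs.continuous.memLp_volOmega)).neg
  have lz := l.add (tendsto_integral_flux_deriv_cutoff hε hE (Fin.last n) hs.continuous)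
  rw [add_zero] at lz
  refine tendsto_nhds_unique (lz.congr fun j => ?_) r
  have := hdiv _ (isTest_cutoff_trigTensor j c k hb)
  simp only [trigTensor_mul] at this
  have e : ∫ x, f x * (cutoff j x.2 * trigTensor c k b x) ∂(volOmega n) =
      ∫ x, cutoff j x.2 * (f * trigTensor c k b) x ∂(volOmega n) := by
    simp only [Pi.mul_apply, mul_left_comm]
  rw [e] at this
  rw [← this, ← integral_add]
  · refine integral_congr_ae (ae_of_all _ fun x => ?_)
    simp only [Fin.sum_univ_castSucc, pderiv_trigTensor_castSucc, pderiv_trigTensor_last c k hd,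
      pderiv_trigTensor_last c k ((contDiff_cutoff j).mul hb |>.differentiable (by simp)),
      deriv_cutoff_mul j hd, trigTensor_mul, mul_add, Finset.mul_sum, mul_left_comm (cutoff j x.2)]
    simp only [trigTensor, Pi.add_apply]
    ring
  · refine hi.bdd_mul (c := 1) ?_ (ae_of_all _ fun x => ?_)
    · exact ((contDiff_cutoff j).continuous.comp continuous_snd).aestronglyMeasurable
    · rw [Real.norm_eq_abs, abs_of_nonneg (cutoff_nonneg _ _)]
      exact cutoff_le_one _ _
  · refine (memLp_flux hε hE _).integrable_mul (Continuous.memLp_volOmega ?_)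
    exact (((contDiff_cutoff j).continuous_deriv (by simp)).comp continuous_snd).mul hs.continuous

/-- Integration by parts produces no boundary term. -/
theorem integral_flux_mul_grad {n : ℕ} {ε : ℝ} (hε : 0 < ε) {u : Cyl n → ℝ} {f : L2 n}
    (hE : energy ε u < ⊤) (hdiv : HasWeakDiv (flux ε u) f) (v : H1 n) :
    ∫ x, ∑ i, flux ε u i x * v.1 (some i) x ∂(volOmega n) =
      -∫ x, f x * v.1 none x ∂(volOmega n) := by
  have hF := memLp_flux hε hE
  have hint : ∀ (i : Fin (n + 1)) {z : Cyl n → ℝ}, MemLp z 2 (volOmega n) →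
      Integrable (fun x => flux ε u i x * z x) (volOmega n) := fun i _ hz =>
    (hF i).integrable_mul hz
  -- The desired identity is the orthogonality of this jet `(f, a ∇u)` to `v`.
  set w : Jet n := WithLp.toLp 2 fun o => o.elim f fun i => (hF i).toLp (flux ε u i)
  have hws : ∀ (i : Fin (n + 1)) (z : Cyl n → ℝ), ∫ x, w (some i) x * z x ∂(volOmega n) =
      ∫ x, flux ε u i x * z x ∂(volOmega n) := by
    intro i z
    refine integral_congr_ae ?_
    filter_upwards [(hF i).coeFn_toLp] with x hx
    exact congrArg (· * _) hx
  have hw : inner ℝ w v.1 = 0 := by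
    refine inner_eq_zero_of_neumannFun (fun c k m => ?_) v.2
    have hs := isSmooth_neumannFun c k m
    have key : ∫ x, ∑ i, flux ε u i x * pderiv i (neumannFun c k m) x ∂(volOmega n) =
        -∫ x, f x * neumannFun c k m x ∂(volOmega n) :=
      integral_flux_mul_pderiv_trigTensor hε hE (Lp.memLp f) hdiv c k (contDiff_cos_mul m)
    rw [integral_finsetSum _ fun i _ => hint i (hs.continuous_pderiv i).memLp_volOmega] at key
    rw [IsSmooth.inner_jet]
    simp only [hws]
    exact (congrArg₂ (· + ·) rfl key).trans (add_neg_cancel _)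
  have hin : ∀ y z : L2 n, inner ℝ y z = ∫ x, y x * z x ∂(volOmega n) := by
    intro y z
    rw [integral_mul_eq_inner y (Lp.memLp z), Lp.toLp_coeFn]
  rw [PiLp.inner_apply, Fintype.sum_option] at hw
  simp only [hin, hws] at hw
  rw [integral_finsetSum _ fun i _ => hint i (Lp.memLp _)]
  exact eq_neg_of_add_eq_zero_right hw

theorem isNormalTrace_flux_zero {n : ℕ} {ε : ℝ} (hε : 0 < ε) {u : Cyl n → ℝ} {f : L2 n}
    (hE : energy ε u < ⊤) (hdiv : HasWeakDiv (flux ε u) f) : IsNormalTrace (flux ε u) f 0 := by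
  refine ⟨memLp_flux hε hE, hdiv, fun v g _ => ?_⟩
  rw [integral_flux_mul_grad hε hE hdiv v, neg_add_cancel]
  rfl

/-- By the definition of `HHalf`, every `g` is the trace of some `v`, and the defining formula
evaluated at that `v` gives `0`. -/
theorem eq_zero_of_isNormalTrace_flux {n : ℕ} {ε : ℝ} (hε : 0 < ε) {u : Cyl n → ℝ} {f : L2 n}
    (hE : energy ε u < ⊤) (hdiv : HasWeakDiv (flux ε u) f) {T : HHalfDual n}
    (hT : IsNormalTrace (flux ε u) f T) : T = 0 := by
  refine Subtype.ext (LinearMap.ext fun g => ?_)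
  obtain ⟨⟨v, g'⟩, hv, hg⟩ := g.2
  have hvg : IsTrace v g.1 := by
    rw [← hg]
    exact hv
  rw [hT.2.2 v g hvg, integral_flux_mul_grad hε hE hdiv v, neg_add_cancel]
  rfl

end FlatCylinder

end

theorem mainTheorem12 (n : ℕ) (ε : ℝ) (hε : 0 < ε)
    (u : FlatCylinder.L2 n) (hE : FlatCylinder.energy ε u < ⊤)
    (f : FlatCylinder.L2 n) (hdiv : FlatCylinder.HasWeakDiv (FlatCylinder.flux ε u) f) :
    (∃! T : FlatCylinder.HHalfDual n,
      FlatCylinder.IsNormalTrace (FlatCylinder.flux ε u) f T) ∧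
    (∀ T : FlatCylinder.HHalfDual n,
      FlatCylinder.IsNormalTrace (FlatCylinder.flux ε u) f T → T = 0) ∧
    (∀ v : FlatCylinder.H1 n,
      ∫ x, ∑ i, FlatCylinder.flux ε u i x * v.1 (some i) x ∂(FlatCylinder.volOmega n) =
        -∫ x, f x * v.1 none x ∂(FlatCylinder.volOmega n)) := by
  have h0 : ∀ T : FlatCylinder.HHalfDual n,
      FlatCylinder.IsNormalTrace (FlatCylinder.flux ε u) f T → T = 0 :=
    fun T hT => FlatCylinder.eq_zero_of_isNormalTrace_flux hε hE hdiv hT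
  exact ⟨⟨0, FlatCylinder.isNormalTrace_flux_zero hε hE hdiv, h0⟩, h0,
    FlatCylinder.integral_flux_mul_grad hε hE hdiv⟩
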